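/- **Setting.** Consider spatially homogeneous spacetimes of Bianchi type V with metric ${}^4g=-dt^2+g_{ab}(t)\,W^aW^b$, where $W^1,W^2,W^3$ is dual to a time-independent left-invariant frame $E_1,E_2,E_3$ with $[E_b,E_c]=C^d_{bc}E_d$, $C^d_{bc}=a_b\delta^d_c-a_c\delta^d_b$, $(a_1,a_2,a_3)=(1,0,0)$. Latin indices run from $1$ to $3$, refer to this frame, and are moved with $g_{ab}$. Let $f(t,p)\ge 0$, $p=(p_1,p_2,p_3)$, be the distribution function of particles of unit mass in terms of the covariant momenta, with compact support in $p$ for each $t$; put $p^0=(1+g^{ab}p_ap_b)^{1/2}$ and $$\rho=\int f\,p^0\sqrt{\det g}\,dp^1dp^2dp^3,\quad j_a=\int f\,p_a\sqrt{\det g}\,dp^1dp^2dp^3,\quad S_{ab}=\int f\,\frac{p_ap_b}{p^0}\sqrt{\det g}\,dp^1dp^2dp^3 .$$ A $C^\infty$ solution on $[t_0,\infty)$ of the Einstein–Vlasov system with Bianchi V symmetry consists of such an $f$, a Riemannian metric $g_{ab}(t)$ and a second fundamental form $k_{ab}(t)$, all smooth up to and including $t_0$, with $$\dot g_{ab}=-2k_{ab},\qquad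 \dot k_{ab}=R_{ab}+k\,k_{ab}-2k_{ac}k^c_b-8\pi\bigl(S_{ab}-\tfrac12 g_{ab}S\bigr)-4\pi\rho\, g_{ab},$$ $$R-k_{ab}k^{ab}+k^2=16\pi\rho,\qquad \nabla^ak_{ab}=8\pi j_b,\qquad \partial_tf+(p^0)^{-1}C^d_{ba}p^bp_d\,\frac{\partial f}{\partial p_a}=0,$$ where $R_{ab}$, $R$, $\nabla$ are the Ricci tensor, the scalar curvature and the Levi-Civita connection of $g_{ab}$, $k=g^{ab}k_{ab}$ and $S=g^{ab}S_{ab}$. Put $H=-k/3$, $\sigma_{ab}=k_{ab}+Hg_{ab}$, $\Sigma^a_b=\sigma^a_b/H$, $\Sigma_+=-\frac12(\Sigma^2_2+\Sigma^3_3)$, $\Sigma_-=-\frac1{2\sqrt3}(\Sigma^2_2-\Sigma^3_3)$, $A=-R/(6H^2)$ and $\mathrm P(t)=\sup\{(g^{ab}p_ap_b)^{1/2}: f(t,p)\ne 0\}$ (with $\sup\emptyset=0$). The time origin is normalized by $t_0=-3/k(t_0)>0$. **Corollary.** There is a constant $\varepsilon>0$ such that for every $C^\infty$ solution on $[t_0,\infty)$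 with $$|\Sigma_+(t_0)|,\ |\Sigma_-(t_0)|,\ |\Sigma^i_j(t_0)|\ (i\ne j),\ |A(t_0)-1|,\ \mathrm P(t_0)\ \le\ \varepsilon,$$ one has, as $t\to\infty$, $$\rho=O(t^{-3}),\qquad j_i=O(t^{-4}),\qquad S_{ij}=O(t^{-5}),$$ where the components of the matter current and of the spatial stress are taken with respect to an arbitrary orthonormal frame of $g(t)$ at each time $t$. -/

import Mathlib

open Set Filter Topology MeasureTheory Asymptotics
open scoped ContDiff Matrix

/-! Spatially homogeneous spacetimes `-dt² + g_{ab}(t) Wᵃ Wᵇ` of Bianchi type V with collisionless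
matter. All tensors are given by their components in the time-independent left-invariant frame
`E₁, E₂, E₃`; the indices 1, 2, 3 are `0, 1, 2 : Fin 3`. -/

noncomputable section

namespace BianchiV

/-- 3 × 3 matrices of tensor components. -/
abbrev Mat := Matrix (Fin 3) (Fin 3) ℝ

/-- Triples of components of a covector (or a vector). -/
abbrev Vec := Fin 3 → ℝ

/-- The covector `(a₁, a₂, a₃) = (1, 0, 0)` of Bianchi type V. -/
def aVec : Vec := ![1, 0, 0]

/-- The structure constants `C^d_{bc} = a_b δ^d_c - a_c δ^d_b` of Bianchi type V, for which
`[E_b, E_c] = C^d_{bc} E_d`. -/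
def structConst (d b c : Fin 3) : ℝ :=
  aVec b * (1 : Mat) d c - aVec c * (1 : Mat) d b

/-- `Γ_{abc} = g(E_a, ∇_{E_c} E_b)` for the Levi-Civita connection of the left-invariant metric `g`
(Koszul formula in a frame in which the components of `g` are constant). -/
def gammaLow (g : Mat) (a b c : Fin 3) : ℝ :=
  (1 / 2) * ∑ d, (structConst d c b * g a d + structConst d a c * g b d
    - structConst d b a * g c d)

/-- `Γ^d_{bc} = g^{da} Γ_{abc}`, so that `∇_{E_c} E_b = Γ^d_{bc} E_d`. -/
def gamma (g : Mat) (d b c : Fin 3) : ℝ := ∑ a, g⁻¹ d a * gammaLow g a b c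

/-- The Ricci tensor `R_{bd}`, the trace over `c` of
`R(E_c, E_d) E_b = ∇_c ∇_d E_b - ∇_d ∇_c E_b - ∇_{[E_c, E_d]} E_b`. -/
def ricci (g : Mat) : Mat := Matrix.of fun b d =>
  ∑ c, ∑ e, (gamma g e b d * gamma g c e c - gamma g e b c * gamma g c e d
    - structConst e c d * gamma g c b e)

/-- The scalar curvature `R = g^{ab} R_{ab}`. -/
def scalarCurv (g : Mat) : ℝ := (g⁻¹ * ricci g).trace

/-- The covariant derivative `∇_c k_{ab}` of a left-invariant symmetric 2-tensor. -/
def covDeriv (g k : Mat) (c a b : Fin 3) : ℝ :=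
  -∑ d, (gamma g d a c * k d b + gamma g d b c * k a d)

/-- The divergence `∇^a k_{ab}`. -/
def divergence (g k : Mat) (b : Fin 3) : ℝ := ∑ a, ∑ c, g⁻¹ a c * covDeriv g k c a b

/-- The mixed components `k^a_b = g^{ac} k_{cb}`. -/
def mixed (g k : Mat) : Mat := g⁻¹ * k

/-- The mean curvature `g^{ab} k_{ab}`. -/
def meanCurv (g k : Mat) : ℝ := (mixed g k).trace

/-- `k_{ab} k^{ab}`. -/
def normSq (g k : Mat) : ℝ := (mixed g k * mixed g k).trace

/-- The Hubble parameter `H = -k / 3`. -/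
def hubble (g k : Mat) : ℝ := -(1 / 3) * meanCurv g k

/-- `Σ^a_b = σ^a_b / H`, where `k_{ab} = σ_{ab} - H g_{ab}`. -/
def shear (g k : Mat) : Mat := (hubble g k)⁻¹ • mixed g (k + hubble g k • g)

/-- `Σ₊ = -(Σ²₂ + Σ³₃) / 2`. -/
def shearPlus (g k : Mat) : ℝ := -(1 / 2) * (shear g k 1 1 + shear g k 2 2)

/-- `Σ₋ = -(Σ²₂ - Σ³₃) / (2√3)`. -/
def shearMinus (g k : Mat) : ℝ := -(1 / (2 * √3)) * (shear g k 1 1 - shear g k 2 2)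

/-- `A = -R / (6 H²)`. -/
def curvVar (g k : Mat) : ℝ := -scalarCurv g / (6 * hubble g k ^ 2)

/-- `|p| = (g^{ab} p_a p_b)^{1/2}` for a covariant spatial momentum. -/
def momentumNorm (g : Mat) (p : Vec) : ℝ := √(p ⬝ᵥ (g⁻¹ *ᵥ p))

/-- `p⁰ = (1 + g^{ab} p_a p_b)^{1/2}`, by the mass shell relation for particles of unit mass. -/
def energy (g : Mat) (p : Vec) : ℝ := √(1 + p ⬝ᵥ (g⁻¹ *ᵥ p))

/-- The supremum `P` of `|p|` over the momenta that occur in the distribution function `f`, a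
function of the covariant components `p_a`. -/
def maxMomentum (g : Mat) (f : Vec → ℝ) : ℝ := sSup {r | ∃ p, f p ≠ 0 ∧ r = momentumNorm g p}

/-- `∫ F(p_a) √(det g) dp¹ dp² dp³`: the integration variable is the contravariant momentum `pᵃ`,
and `F` is evaluated at `p_a = g_{ab} pᵇ`. -/
def momentumIntegral (g : Mat) (F : Vec → ℝ) : ℝ := ∫ v : Vec, F (g *ᵥ v) * √g.det

/-- The energy density `ρ = T⁰⁰`. -/
def rho (g : Mat) (f : Vec → ℝ) : ℝ := momentumIntegral g fun p => f p * energy g p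

/-- The matter current `j_a = T_a⁰ = -T_{0a}`. -/
def current (g : Mat) (f : Vec → ℝ) (a : Fin 3) : ℝ := momentumIntegral g fun p => f p * p a

/-- The spatial part `S_{ab} = T_{ab}` of the energy-momentum tensor. -/
def stress (g : Mat) (f : Vec → ℝ) : Mat := Matrix.of fun a b =>
  momentumIntegral g fun p => f p * (p a * p b) * (energy g p)⁻¹

/-- `S = g^{ab} S_{ab}`. -/
def stressTrace (g : Mat) (f : Vec → ℝ) : ℝ := (g⁻¹ * stress g f).trace

/-- The force `(p⁰)⁻¹ C^d_{ba} pᵇ p_d` acting on `p_a`. -/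
def force (g : Mat) (p : Vec) (a : Fin 3) : ℝ :=
  (energy g p)⁻¹ * ∑ b, ∑ d, structConst d b a * (g⁻¹ *ᵥ p) b * p d

/-- `(g, k, f)` is a smooth solution on `[t₀, ∞)` of the Einstein-Vlasov system with Bianchi V
symmetry: `g` is the spatial metric, `k` the second fundamental form, and `f` the distribution
function in terms of the covariant momenta `p_a`, with compact support in momentum space at each
time. -/
structure IsSolution (t₀ : ℝ) (g k : ℝ → Mat) (f : ℝ → Vec → ℝ) : Prop where
  metric_posDef : ∀ t ∈ Ici t₀, (g t).PosDef
  metric_smooth : ∀ a b, ContDiffOn ℝ ∞ (fun t => g t a b) (Ici t₀)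
  second_smooth : ∀ a b, ContDiffOn ℝ ∞ (fun t => k t a b) (Ici t₀)
  distr_smooth : ContDiffOn ℝ ∞ (fun x : ℝ × Vec => f x.1 x.2) (Ici t₀ ×ˢ univ)
  distr_nonneg : ∀ t ∈ Ici t₀, ∀ p, 0 ≤ f t p
  distr_compact : ∀ t ∈ Ici t₀, HasCompactSupport (f t)
  metric_evolution : ∀ t ∈ Ici t₀, ∀ a b,
    HasDerivWithinAt (fun s => g s a b) (-2 * k t a b) (Ici t₀) t
  einstein_evolution : ∀ t ∈ Ici t₀, ∀ a b,
    HasDerivWithinAt (fun s => k s a b)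
      (ricci (g t) a b + meanCurv (g t) (k t) * k t a b
        - 2 * ∑ c, k t a c * mixed (g t) (k t) c b
        - 8 * Real.pi * (stress (g t) (f t) a b - 1 / 2 * g t a b * stressTrace (g t) (f t))
        - 4 * Real.pi * rho (g t) (f t) * g t a b)
      (Ici t₀) t
  hamiltonian_constraint : ∀ t ∈ Ici t₀,
    scalarCurv (g t) - normSq (g t) (k t) + meanCurv (g t) (k t) ^ 2
      = 16 * Real.pi * rho (g t) (f t)
  momentum_constraint : ∀ t ∈ Ici t₀, ∀ b,
    divergence (g t) (k t) b = 8 * Real.pi * current (g t) (f t) b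
  vlasov : ∀ t ∈ Ici t₀, ∀ p : Vec,
    derivWithin (fun s => f s p) (Ici t₀) t
      + ∑ a, force (g t) p a * fderiv ℝ (f t) p (Pi.single a 1) = 0

/-- At each `t ≥ t₀` the columns of `e t` are the components `e_a = e^i_a E_i` of a spatial frame
that is orthonormal for `g t`. -/
def IsOrthonormalFrame (t₀ : ℝ) (g e : ℝ → Mat) : Prop :=
  ∀ t ∈ Ici t₀, (e t)ᵀ * g t * e t = 1

/-- The components `e^i_a j_i` of a covector in the frame `e`. -/
def frameVec (e : Mat) (j : Vec) : Vec := eᵀ *ᵥ j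

/-- The components `e^i_a e^l_b S_{il}` of a covariant 2-tensor in the frame `e`. -/
def frameMat (e S : Mat) : Mat := eᵀ * S * e

end BianchiV

end

open Set Filter Topology MeasureTheory Asymptotics
open scoped ContDiff Matrix

noncomputable section

namespace BianchiV

/-! ### Orthonormal frames -/

/-! Everything is read off from three scalars: `H`, `D = 1 - A`, and an upper bound `W` for the
squared momenta in the support of `f`. A left-invariant metric of type V has constant curvature
`-g⁰⁰` (`ricci_eq`), so the Hamiltonian constraint becomes `6 H² D = |σ|² + 16πρ`: smallness of `D`
alone controls both the shear and the matter. The momentum constraint expresses `σ⁰⁰`, the only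
shear component in the derivative of `g⁰⁰`, through `j`, and `|j⁰| ≤ (g⁰⁰)^{1/2} √W ρ`. Hence `D' ≤
H D (2√W + D - 1)` (`IsSolution.curvDeviation_deriv_le`). The force is orthogonal to the momentum,
so along the Vlasov flow `|p|²` changes only at the rate `2 k^{ab} p_a p_b ≤ 2 (|σ| - H) |p|²`. A
maximum principle for the transport operator, used in place of characteristics, turns this into the
support bound by `W` (`IsSolution.norm_le_of_distr_ne_zero`) and into a bound on `f` by its initial
supremum (`IsSolution.distr_le`). The system for `H`, `D`, `W` closes for small data: `D + W` stays
small and decays, which makes `W / H²` bounded, while `H' ≤ -H²` gives `H ≤ 1/t`. Thus `W = O(t⁻²)`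
(`exists_le_div_sq`). A bounded density on a ball of radius `O(1/t)` has `ρ = O(t⁻³)`; each
orthonormal momentum component in the integrand adds a factor `1/t`. -/

open scoped MatrixOrder Matrix.Norms.L2Operator in
theorem exists_eq_transpose_mul_self {g : Mat} (hg : g.PosDef) : ∃ B : Mat, g = Bᵀ * B := by
  obtain ⟨B, hB⟩ := CStarAlgebra.nonneg_iff_eq_star_mul_self.mp hg.posSemidef.nonneg
  exact ⟨B, by simpa [Matrix.star_eq_conjTranspose] using hB⟩

theorem exists_orthonormal {g : Mat} (hg : g.PosDef) : ∃ e : Mat, eᵀ * g * e = 1 := by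
  obtain ⟨B, rfl⟩ := exists_eq_transpose_mul_self hg
  have hB : IsUnit B.det := by
    have h := hg.det_pos.ne'
    rw [Matrix.det_mul, Matrix.det_transpose] at h
    exact (right_ne_zero_of_mul h).isUnit
  refine ⟨B⁻¹, ?_⟩
  rw [← mul_assoc, ← Matrix.transpose_mul, mul_assoc, Matrix.mul_nonsing_inv _ hB]
  simp

theorem inv_eq_of_orthonormal {g e : Mat} (h : eᵀ * g * e = 1) : g⁻¹ = e * eᵀ := by
  apply Matrix.inv_eq_right_inv
  rw [← mul_assoc]
  apply mul_eq_one_comm.1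
  rw [← mul_assoc, h]

theorem quadForm_inv_eq {g e : Mat} (h : eᵀ * g * e = 1) (p q : Vec) :
    p ⬝ᵥ (g⁻¹ *ᵥ q) = (eᵀ *ᵥ p) ⬝ᵥ (eᵀ *ᵥ q) := by
  rw [inv_eq_of_orthonormal h, ← Matrix.mulVec_mulVec, Matrix.dotProduct_mulVec,
    ← Matrix.mulVec_transpose]

theorem sq_dotProduct_le {n : Type*} [Fintype n] (x y : n → ℝ) :
    (x ⬝ᵥ y) ^ 2 ≤ (x ⬝ᵥ x) * (y ⬝ᵥ y) := by
  simpa [dotProduct, sq] using Finset.sum_mul_sq_le_sq_mul_sq Finset.univ x y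

theorem sq_quadForm_inv_le {g : Mat} (hg : g.PosDef) (p q : Vec) :
    (p ⬝ᵥ (g⁻¹ *ᵥ q)) ^ 2 ≤ (p ⬝ᵥ (g⁻¹ *ᵥ p)) * (q ⬝ᵥ (g⁻¹ *ᵥ q)) := by
  obtain ⟨e, he⟩ := exists_orthonormal hg
  simp only [quadForm_inv_eq he]
  exact sq_dotProduct_le _ _

theorem quadForm_inv_nonneg {g : Mat} (hg : g.PosDef) (p : Vec) : 0 ≤ p ⬝ᵥ (g⁻¹ *ᵥ p) := by
  obtain ⟨e, he⟩ := exists_orthonormal hg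
  rw [quadForm_inv_eq he]
  exact Finset.sum_nonneg fun i _ => mul_self_nonneg _

/-- Cauchy–Schwarz against `g e_a`, whose squared dual norm is `g_{aa}`. It makes `|p|²` coercive in
the coordinate norm. -/
theorem sq_apply_le {g : Mat} (hg : g.PosDef) (p : Vec) (a : Fin 3) :
    p a ^ 2 ≤ g a a * (p ⬝ᵥ (g⁻¹ *ᵥ p)) := by
  have hu : IsUnit g.det := hg.det_pos.ne'.isUnit
  have h := sq_quadForm_inv_le hg p (g *ᵥ Pi.single a 1)
  rw [Matrix.mulVec_mulVec, Matrix.nonsing_inv_mul _ hu, Matrix.one_mulVec] at h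
  rw [mul_comm]
  simpa using h

theorem normSq_eq_sum {g e : Mat} (h : eᵀ * g * e = 1) {s : Mat} (hs : sᵀ = s) :
    normSq g s = ∑ i, ∑ j, (eᵀ * s * e) i j ^ 2 := by
  have hsym : (eᵀ * s * e)ᵀ = eᵀ * s * e := by
    simp [Matrix.transpose_mul, hs, mul_assoc]
  have h1 : normSq g s = ((eᵀ * s * e) * (eᵀ * s * e)).trace := by
    rw [normSq, mixed, inv_eq_of_orthonormal h, mul_assoc e, mul_assoc e, Matrix.trace_mul_comm]
    simp only [mul_assoc]
  rw [h1, Matrix.trace]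
  refine Finset.sum_congr rfl fun i _ => ?_
  rw [Matrix.diag_apply, Matrix.mul_apply]
  refine Finset.sum_congr rfl fun j _ => ?_
  rw [sq, ← Matrix.transpose_apply (eᵀ * s * e) i j, hsym]

theorem normSq_nonneg {g : Mat} (hg : g.PosDef) {s : Mat} (hs : sᵀ = s) : 0 ≤ normSq g s := by
  obtain ⟨e, he⟩ := exists_orthonormal hg
  rw [normSq_eq_sum he hs]
  positivity

theorem sq_dotProduct_mulVec_le (s : Mat) (x : Vec) :
    (x ⬝ᵥ (s *ᵥ x)) ^ 2 ≤ (∑ i, ∑ j, s i j ^ 2) * (x ⬝ᵥ x) ^ 2 := by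
  have h1 := sq_dotProduct_le x (s *ᵥ x)
  have h2 : (s *ᵥ x) ⬝ᵥ (s *ᵥ x) ≤ (∑ i, ∑ j, s i j ^ 2) * (x ⬝ᵥ x) := by
    rw [dotProduct, Finset.sum_mul]
    refine Finset.sum_le_sum fun i _ => ?_
    have := sq_dotProduct_le (s i) x
    simpa [Matrix.mulVec, sq, dotProduct] using this
  have h3 : 0 ≤ x ⬝ᵥ x := Finset.sum_nonneg fun i _ => mul_self_nonneg _
  calc _ ≤ _ := h1
    _ ≤ (x ⬝ᵥ x) * ((∑ i, ∑ j, s i j ^ 2) * (x ⬝ᵥ x)) := by gcongr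
    _ = _ := by ring

/-- `|s^{ab} p_a p_b| ≤ |s| |p|²`. -/
theorem abs_contract_le {g : Mat} (hg : g.PosDef) {s : Mat} (hs : sᵀ = s) (p : Vec) :
    |p ⬝ᵥ ((g⁻¹ * s * g⁻¹) *ᵥ p)| ≤ √(normSq g s) * (p ⬝ᵥ (g⁻¹ *ᵥ p)) := by
  obtain ⟨e, he⟩ := exists_orthonormal hg
  have h1 : p ⬝ᵥ ((g⁻¹ * s * g⁻¹) *ᵥ p) = (eᵀ *ᵥ p) ⬝ᵥ ((eᵀ * s * e) *ᵥ (eᵀ *ᵥ p)) := by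
    rw [inv_eq_of_orthonormal he, Matrix.mulVec_mulVec, Matrix.mulVec_transpose,
      ← Matrix.dotProduct_mulVec, Matrix.mulVec_mulVec]
    simp only [mul_assoc]
  have h2 := sq_dotProduct_mulVec_le (eᵀ * s * e) (eᵀ *ᵥ p)
  rw [← normSq_eq_sum he hs, ← h1, ← quadForm_inv_eq he] at h2
  have h3 := quadForm_inv_nonneg hg p
  apply abs_le_of_sq_le_sq _ (by positivity)
  rw [mul_pow, Real.sq_sqrt (normSq_nonneg hg hs)]
  exact h2

/-! ### Geometry of Bianchi type V -/

theorem gammaLow_eq {g : Mat} (hg : gᵀ = g) (a b c : Fin 3) :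
    gammaLow g a b c = aVec a * g b c - aVec b * g a c := by
  have h : ∀ i j, g i j = g j i := fun i j => by rw [← Matrix.transpose_apply g i j, hg]
  simp only [gammaLow, structConst, sub_mul, mul_assoc, Finset.sum_add_distrib,
    Finset.sum_sub_distrib, ← Finset.mul_sum, Matrix.one_apply, ite_mul, one_mul, zero_mul,
    Finset.sum_ite_eq', Finset.mem_univ, if_true]
  rw [h b a, h c a, h c b]
  ring

theorem gamma_eq {g : Mat} (hg : g.PosDef) (d b c : Fin 3) :
    gamma g d b c = g⁻¹ d 0 * g b c - aVec b * (1 : Mat) d c := by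
  have hu : IsUnit g.det := hg.det_pos.ne'.isUnit
  have hs : gᵀ = g := by simpa using hg.isHermitian.eq
  rw [← Matrix.nonsing_inv_mul _ hu, Matrix.mul_apply, Finset.mul_sum]
  simp only [gamma, gammaLow_eq hs, mul_sub, Finset.sum_sub_distrib]
  congr 1
  · simp [Fin.sum_univ_three, aVec]
  · exact Finset.sum_congr rfl fun i _ => by ring

/-- The first row of `g⁻¹ g = 1`, with the entries of `g⁻¹` indexed as they occur in `gamma_eq`;
these are the relations that close the Ricci computation. -/
theorem inv_relation {g : Mat} (hg : g.PosDef) (b : Fin 3) :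
    g⁻¹ 0 0 * g 0 b + g⁻¹ 1 0 * g 1 b + g⁻¹ 2 0 * g 2 b = aVec b := by
  have hu : IsUnit g.det := hg.det_pos.ne'.isUnit
  have hs : gᵀ = g := by simpa using hg.isHermitian.eq
  have hs' : g⁻¹ᵀ = g⁻¹ := by rw [Matrix.transpose_nonsing_inv, hs]
  have h := congrFun (congrFun (Matrix.nonsing_inv_mul _ hu) 0) b
  rw [Matrix.mul_apply, Fin.sum_univ_three] at h
  rw [← hs'] at h
  simp only [Matrix.transpose_apply] at h
  rw [h]
  fin_cases b <;> simp [aVec, Matrix.one_apply]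

/-- Type V metrics are hyperbolic, of sectional curvature `-g⁰⁰`. Curvature therefore contributes no
traceless part, and `A = g⁰⁰ / H²`. -/
theorem ricci_eq {g : Mat} (hg : g.PosDef) : ricci g = (-2 * g⁻¹ 0 0) • g := by
  have hs : gᵀ = g := by simpa using hg.isHermitian.eq
  have h : ∀ i j, g i j = g j i := fun i j => by rw [← Matrix.transpose_apply g i j, hs]
  have r0 := inv_relation hg 0
  have r1 := inv_relation hg 1
  have r2 := inv_relation hg 2
  have h10 := h 1 0
  have h20 := h 2 0
  have h21 := h 2 1
  ext b d
  simp only [ricci, Matrix.of_apply, gamma_eq hg, Matrix.smul_apply, smul_eq_mul, structConst]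
  fin_cases b <;> fin_cases d <;> simp [Fin.sum_univ_three, aVec, Matrix.one_apply] at * <;> grind

theorem scalarCurv_eq {g : Mat} (hg : g.PosDef) : scalarCurv g = -6 * g⁻¹ 0 0 := by
  have hu : IsUnit g.det := hg.det_pos.ne'.isUnit
  rw [scalarCurv, ricci_eq hg, Matrix.mul_smul, Matrix.nonsing_inv_mul _ hu]
  simp
  ring

theorem divergence_eq {g k : Mat} (hg : g.PosDef) (hk : kᵀ = k) (b : Fin 3) :
    divergence g k b = aVec b * meanCurv g k - 3 * (g⁻¹ * k) 0 b := by
  have hu : IsUnit g.det := hg.det_pos.ne'.isUnit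
  have hs : gᵀ = g := by simpa using hg.isHermitian.eq
  have hi : g⁻¹ᵀ = g⁻¹ := by rw [Matrix.transpose_nonsing_inv, hs]
  have hks : ∀ i j, k i j = k j i := fun i j => by rw [← Matrix.transpose_apply k i j, hk]
  have hgs : ∀ i j, g i j = g j i := fun i j => by rw [← Matrix.transpose_apply g i j, hs]
  have his : ∀ i j, g⁻¹ i j = g⁻¹ j i := fun i j => by rw [← Matrix.transpose_apply g⁻¹ i j, hi]
  have hr : ∀ a b, ∑ c, g⁻¹ a c * g b c = (1 : Mat) a b := fun a b => by
    rw [← Matrix.nonsing_inv_mul _ hu, Matrix.mul_apply]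
    exact Finset.sum_congr rfl fun c _ => by rw [hgs b c]
  have h2 : ∀ a c, ∑ d, (gamma g d a c * k d b + gamma g d b c * k a d)
      = g a c * (g⁻¹ * k) 0 b - aVec a * k c b + g b c * (g⁻¹ * k) 0 a - aVec b * k a c := by
    intro a c
    simp only [gamma_eq hg, Matrix.mul_apply, Matrix.one_apply, Fin.sum_univ_three, his 0, hks a]
    fin_cases c <;> simp <;> ring
  simp only [divergence, covDeriv, h2]
  have h3 : ∀ a c, g⁻¹ a c * -(g a c * (g⁻¹ * k) 0 b - aVec a * k c b + g b c * (g⁻¹ * k) 0 a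
      - aVec b * k a c) = -(g⁻¹ * k) 0 b * (g⁻¹ a c * g a c) + aVec a * (g⁻¹ a c * k c b)
        - (g⁻¹ * k) 0 a * (g⁻¹ a c * g b c) + aVec b * (g⁻¹ a c * k c a) := fun a c => by
    rw [hks a c]; ring
  simp only [h3, Finset.sum_add_distrib, Finset.sum_sub_distrib, ← Finset.mul_sum, hr,
    ← Matrix.mul_apply]
  rw [meanCurv, mixed, Matrix.trace]
  simp [Fin.sum_univ_three, aVec]
  ring

/-! ### Differential inequalities -/

theorem antitoneOn_Ici {t₀ : ℝ} {u u' : ℝ → ℝ}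
    (hu : ∀ t ∈ Ici t₀, HasDerivWithinAt u (u' t) (Ici t₀) t) (h : ∀ t ∈ Ici t₀, u' t ≤ 0) :
    AntitoneOn u (Ici t₀) :=
  antitoneOn_of_hasDerivWithinAt_nonpos (convex_Ici t₀)
    (fun t ht => (hu t ht).continuousWithinAt)
    (fun t ht => (hu t (interior_subset ht)).mono interior_subset)
    (fun t ht => h t (interior_subset ht))

/-- The continuity argument: the level `δ` cannot be crossed upwards, since the derivative is
negative whenever it is reached. -/
theorem le_const_of_deriv_neg {t₀ δ : ℝ} {u u' : ℝ → ℝ}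
    (hu : ∀ t ∈ Ici t₀, HasDerivWithinAt u (u' t) (Ici t₀) t) (h₀ : u t₀ ≤ δ)
    (h : ∀ t ∈ Ici t₀, u t = δ → u' t < 0) : ∀ t ∈ Ici t₀, u t ≤ δ := by
  intro t ht
  refine image_le_of_deriv_right_lt_deriv_boundary (f := u) (f' := u') (a := t₀) (b := t)
    (B := fun _ => δ) (B' := fun _ => 0) ?_ ?_ h₀ (fun x => hasDerivAt_const x δ) ?_ ⟨ht, le_rfl⟩
  · exact fun s hs => (hu s hs.1).continuousWithinAt.mono Icc_subset_Ici_self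
  · exact fun s hs => (hu s hs.1).mono (Ici_subset_Ici.2 hs.1)
  · exact fun s hs hs' => h s hs.1 hs'

theorem le_inv_of_deriv_le {t₀ : ℝ} (ht₀ : 0 < t₀) {H H' : ℝ → ℝ}
    (hH : ∀ t ∈ Ici t₀, HasDerivWithinAt H (H' t) (Ici t₀) t)
    (hpos : ∀ t ∈ Ici t₀, 0 < H t) (hle : ∀ t ∈ Ici t₀, H' t ≤ -H t ^ 2)
    (h₀ : H t₀ = t₀⁻¹) : ∀ t ∈ Ici t₀, H t ≤ t⁻¹ := by
  intro t ht
  -- `(1/H)' = -H'/H² ≥ 1`, and `t - 1/H` vanishes at `t₀`.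
  have hanti : AntitoneOn (fun s => s - (H s)⁻¹) (Ici t₀) :=
    antitoneOn_Ici (u' := fun s => 1 - (-H' s / H s ^ 2))
      (fun s hs => (hasDerivWithinAt_id s _).sub ((hH s hs).inv (hpos s hs).ne'))
      fun s hs => by
        have hp := hpos s hs
        rw [sub_nonpos, le_div_iff₀ (by positivity)]
        linarith [hle s hs]
  have h := hanti (self_mem_Ici) ht ht
  simp only [h₀, inv_inv, sub_self] at h
  have ht' : 0 < t := ht₀.trans_le ht
  rw [← inv_inv (H t)]
  exact inv_anti₀ ht' (by linarith)

/-- A quantity controlled by a small, decaying one is `O(t⁻²)`. -/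
theorem exists_le_div_sq {t₀ : ℝ} (ht₀ : 0 < t₀) {H D W H' D' W' : ℝ → ℝ}
    (hH : ∀ t ∈ Ici t₀, HasDerivWithinAt H (H' t) (Ici t₀) t)
    (hD : ∀ t ∈ Ici t₀, HasDerivWithinAt D (D' t) (Ici t₀) t)
    (hW : ∀ t ∈ Ici t₀, HasDerivWithinAt W (W' t) (Ici t₀) t)
    (Hpos : ∀ t ∈ Ici t₀, 0 < H t) (Dnonneg : ∀ t ∈ Ici t₀, 0 ≤ D t)
    (Wpos : ∀ t ∈ Ici t₀, 0 < W t)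
    (H'_le : ∀ t ∈ Ici t₀, H' t ≤ -H t ^ 2)
    (le_H' : ∀ t ∈ Ici t₀, -H t ^ 2 * (1 + 3 * D t) ≤ H' t)
    (D'_le : ∀ t ∈ Ici t₀, D' t ≤ H t * D t * (2 * √(W t) + D t - 1))
    (W'_le : ∀ t ∈ Ici t₀, W' t ≤ 2 * H t * W t * (√(6 * D t) - 1))
    (h₀ : H t₀ = t₀⁻¹) (hsmall : D t₀ + W t₀ ≤ 1 / 100) :
    ∃ C, 0 < C ∧ ∀ t ∈ Ici t₀, W t ≤ C / t ^ 2 := by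
  have hX : ∀ t ∈ Ici t₀, HasDerivWithinAt (fun s => D s + W s) (D' t + W' t) (Ici t₀) t :=
    fun t ht => (hD t ht).add (hW t ht)
  have hX' : ∀ t ∈ Ici t₀, D t + W t ≤ 1 / 100 → D' t + W' t ≤ -(1 / 2) * H t * (D t + W t) := by
    intro t ht hle
    have hd := Dnonneg t ht
    have hw := Wpos t ht
    have hh := Hpos t ht
    have h1 : √(W t) ≤ 1 / 10 := by
      rw [Real.sqrt_le_iff]; constructor <;> nlinarith
    have h2 : √(6 * D t) ≤ 1 / 4 := by
      rw [Real.sqrt_le_iff]; constructor <;> nlinarith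
    have h3 : H t * D t * (2 * √(W t) + D t - 1) ≤ H t * D t * (-(1 / 2)) := by
      gcongr; linarith
    have h4 : 2 * H t * W t * (√(6 * D t) - 1) ≤ 2 * H t * W t * (-(1 / 4)) := by
      gcongr; linarith
    linarith [D'_le t ht, W'_le t ht]
  have Xpos : ∀ t ∈ Ici t₀, 0 < D t + W t := fun t ht =>
    add_pos_of_nonneg_of_pos (Dnonneg t ht) (Wpos t ht)
  have hXle : ∀ t ∈ Ici t₀, D t + W t ≤ 1 / 100 :=
    le_const_of_deriv_neg hX hsmall fun t ht h => by
      nlinarith [hX' t ht h.le, Hpos t ht]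
  set Y : ℝ → ℝ := fun t => √(D t + W t) with hYdef
  have hY : ∀ t ∈ Ici t₀,
      HasDerivWithinAt Y ((D' t + W' t) / (2 * Y t)) (Ici t₀) t :=
    fun t ht => (hX t ht).sqrt (Xpos t ht).ne'
  -- The logarithmic derivative of `W / H²` is only bounded by a multiple of `H √D`, not of `H D`.
  -- Since `Y = √(D + W)` satisfies `Y' ≤ -H Y / 4`, the factor `exp (24 Y)` absorbs this error and
  -- gives the exact rate `t⁻²`.
  set Z : ℝ → ℝ := fun t => W t * Real.exp (24 * Y t) * (H t ^ 2)⁻¹ with hZdef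
  have hZ : ∀ t ∈ Ici t₀, HasDerivWithinAt Z
      ((W' t * Real.exp (24 * Y t)
          + W t * (Real.exp (24 * Y t) * (24 * ((D' t + W' t) / (2 * Y t))))) * (H t ^ 2)⁻¹
        + W t * Real.exp (24 * Y t) * (-((2 : ℕ) * H t ^ (2 - 1) * H' t) / (H t ^ 2) ^ 2))
      (Ici t₀) t := fun t ht =>
    ((hW t ht).mul ((hY t ht).const_mul 24).exp).mul
      (((hH t ht).pow 2).inv (pow_pos (Hpos t ht) 2).ne')
  have hanti : AntitoneOn Z (Ici t₀) := antitoneOn_Ici hZ fun t ht => by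
    have hd := Dnonneg t ht
    have hw := Wpos t ht
    have hh := Hpos t ht
    have hx := Xpos t ht
    have hxle := hXle t ht
    have hy : 0 < Y t := Real.sqrt_pos.2 hx
    have hysq : Y t ^ 2 = D t + W t := Real.sq_sqrt hx.le
    have hyle : Y t ≤ 1 / 10 := by
      simp only [hYdef]
      rw [Real.sqrt_le_iff]; constructor <;> nlinarith
    have hs : √(6 * D t) ≤ 5 / 2 * Y t := by
      rw [Real.sqrt_le_iff]; constructor <;> nlinarith
    have h1 : (D' t + W' t) / (2 * Y t) ≤ -(1 / 4) * H t * Y t := by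
      rw [div_le_iff₀ (by positivity)]
      have := hX' t ht hxle
      rw [← hysq] at this
      linarith
    have h2 : W' t ≤ 2 * H t * W t * (5 / 2 * Y t - 1) :=
      (W'_le t ht).trans (by gcongr)
    have h3 : -H' t ≤ H t ^ 2 * (1 + 3 / 10 * Y t) := by
      have : H t ^ 2 * (1 + 3 * D t) ≤ H t ^ 2 * (1 + 3 / 10 * Y t) := by
        have : 3 * D t ≤ 3 / 10 * Y t := by nlinarith
        gcongr
      linarith [le_H' t ht]
    -- After the leading terms `∓2H` cancel, the terms in `W H Y` have coefficients `5` (from `W'`),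
    -- `3/5` (from `H'`) and `-24/4 = -6` (from `Y'`), with negative sum.
    have key : W' t + W t * (24 * ((D' t + W' t) / (2 * Y t))) + W t * (2 * -H' t / H t) ≤ 0 := by
      have h4 : 2 * -H' t / H t ≤ 2 * H t * (1 + 3 / 10 * Y t) := by
        rw [div_le_iff₀ hh]; linarith
      have h5 := mul_le_mul_of_nonneg_left h4 hw.le
      have h6 := mul_le_mul_of_nonneg_left h1 hw.le
      have h7 : 0 ≤ W t * (H t * Y t) := by positivity
      linarith
    have : (W' t * Real.exp (24 * Y t)
          + W t * (Real.exp (24 * Y t) * (24 * ((D' t + W' t) / (2 * Y t))))) * (H t ^ 2)⁻¹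
        + W t * Real.exp (24 * Y t) * (-((2 : ℕ) * H t ^ (2 - 1) * H' t) / (H t ^ 2) ^ 2)
        = (Real.exp (24 * Y t) * (H t ^ 2)⁻¹) *
          (W' t + W t * (24 * ((D' t + W' t) / (2 * Y t))) + W t * (2 * -H' t / H t)) := by
      generalize (D' t + W' t) / (2 * Y t) = q
      field_simp
      push_cast
      ring
    rw [this]
    exact mul_nonpos_of_nonneg_of_nonpos (by positivity) key
  have hHle := le_inv_of_deriv_le ht₀ hH Hpos H'_le h₀
  refine ⟨Z t₀, ?_, fun t ht => ?_⟩
  · have := Wpos t₀ self_mem_Ici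
    have := Hpos t₀ self_mem_Ici
    positivity
  · have hz := hanti self_mem_Ici ht ht
    have ht' : 0 < t := ht₀.trans_le ht
    have hh := Hpos t ht
    have hw := Wpos t ht
    have h1 : W t * (H t ^ 2)⁻¹ ≤ Z t := by
      simp only [hZdef]
      gcongr
      exact le_mul_of_one_le_right hw.le (Real.one_le_exp (by positivity))
    have h2 : t ^ 2 ≤ (H t ^ 2)⁻¹ := by
      rw [← inv_pow]
      have := (le_inv_comm₀ ht' hh).2 (hHle t ht)
      gcongr
    rw [le_div_iff₀ (by positivity)]
    calc W t * t ^ 2 ≤ W t * (H t ^ 2)⁻¹ := by gcongr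
      _ ≤ Z t₀ := h1.trans hz

/-! ### Time derivatives -/

section Inverse

attribute [local instance] Matrix.linftyOpNormedRing Matrix.linftyOpNormedAlgebra

/-- The local norm only serves to make matrices a Banach algebra, where inversion has derivative `x
↦ -g⁻¹ x g⁻¹`; the entrywise conclusion does not depend on it. -/
theorem hasDerivWithinAt_inv_apply {g : ℝ → Mat} {g' : Mat} {s : Set ℝ} {t : ℝ}
    (hg : ∀ a b, HasDerivWithinAt (fun r => g r a b) (g' a b) s t) (ht : IsUnit (g t))
    (a b : Fin 3) :
    HasDerivWithinAt (fun r => (g r)⁻¹ a b) (-((g t)⁻¹ * g' * (g t)⁻¹) a b) s t := by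
  have h1 : HasDerivWithinAt g g' s t :=
    hasDerivWithinAt_pi.2 fun a => hasDerivWithinAt_pi.2 fun b => hg a b
  obtain ⟨u, hu⟩ := ht
  have h2 := hasFDerivAt_ringInverse (𝕜 := ℝ) u
  rw [hu] at h2
  have h3 := h2.comp_hasDerivWithinAt t h1
  have h4 := hasDerivWithinAt_pi.1 (hasDerivWithinAt_pi.1 h3 a) b
  have h5 : (↑u⁻¹ : Mat) = (g t)⁻¹ := by
    rw [← hu, Matrix.nonsing_inv_eq_ringInverse, Ring.inverse_unit]
  simpa [Matrix.nonsing_inv_eq_ringInverse, h5] using h4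

end Inverse

theorem hasDerivWithinAt_trace_mul {A B : ℝ → Mat} {A' B' : Mat} {s : Set ℝ} {t : ℝ}
    (hA : ∀ a b, HasDerivWithinAt (fun r => A r a b) (A' a b) s t)
    (hB : ∀ a b, HasDerivWithinAt (fun r => B r a b) (B' a b) s t) :
    HasDerivWithinAt (fun r => (A r * B r).trace) ((A' * B t).trace + (A t * B').trace) s t := by
  simp only [Matrix.trace, Matrix.diag_apply, Matrix.mul_apply, ← Finset.sum_add_distrib]
  exact HasDerivWithinAt.fun_sum fun a _ => HasDerivWithinAt.fun_sum fun b _ =>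
    (hA a b).mul (hB b a)

variable {t₀ : ℝ} {g k : ℝ → Mat} {f : ℝ → Vec → ℝ}

theorem IsSolution.metric_symm (h : IsSolution t₀ g k f) {t : ℝ} (ht : t ∈ Ici t₀) :
    (g t)ᵀ = g t := by
  simpa using (h.metric_posDef t ht).isHermitian.eq

/-- Symmetry is inherited from `g`, as `-2k` is its derivative. -/
theorem IsSolution.second_symm (h : IsSolution t₀ g k f) {t : ℝ} (ht : t ∈ Ici t₀) :
    (k t)ᵀ = k t := by
  ext a b
  have h1 := h.metric_evolution t ht b a
  have h2 : HasDerivWithinAt (fun s => g s b a) (-2 * k t a b) (Ici t₀) t :=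
    (h.metric_evolution t ht a b).congr_of_mem
      (fun s hs => by rw [← Matrix.transpose_apply (g s), h.metric_symm hs]) ht
  have := (uniqueDiffOn_Ici t₀ t ht).eq_deriv _ h1 h2
  rw [Matrix.transpose_apply]
  linarith

theorem IsSolution.hasDerivWithinAt_inv (h : IsSolution t₀ g k f) {t : ℝ} (ht : t ∈ Ici t₀)
    (a b : Fin 3) :
    HasDerivWithinAt (fun r => (g r)⁻¹ a b) (2 * ((g t)⁻¹ * k t * (g t)⁻¹) a b) (Ici t₀) t := by
  have h1 := hasDerivWithinAt_inv_apply (g' := (-2 : ℝ) • k t)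
    (by simpa using h.metric_evolution t ht) (h.metric_posDef t ht).isUnit a b
  simpa using h1

theorem IsSolution.hasDerivWithinAt_meanCurv (h : IsSolution t₀ g k f) {t : ℝ}
    (ht : t ∈ Ici t₀) :
    HasDerivWithinAt (fun r => meanCurv (g r) (k r))
      (normSq (g t) (k t) + 4 * Real.pi * (rho (g t) (f t) + stressTrace (g t) (f t)))
      (Ici t₀) t := by
  have hu : IsUnit (g t).det := (h.metric_posDef t ht).det_pos.ne'.isUnit
  have h1 := hasDerivWithinAt_trace_mul (A := fun r => (g r)⁻¹) (B := k)
    (A' := (2 : ℝ) • ((g t)⁻¹ * k t * (g t)⁻¹))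
    (B' := ricci (g t) + meanCurv (g t) (k t) • k t - (2 : ℝ) • (k t * mixed (g t) (k t))
      - (8 * Real.pi) • (stress (g t) (f t) - (1 / 2 * stressTrace (g t) (f t)) • g t)
      - (4 * Real.pi * rho (g t) (f t)) • g t)
    (fun a b => by simpa using h.hasDerivWithinAt_inv ht a b)
    (fun a b => by
      convert h.einstein_evolution t ht a b using 1
      simp only [Matrix.sub_apply, Matrix.add_apply, Matrix.smul_apply, Matrix.mul_apply,
        smul_eq_mul]
      ring)
  refine h1.congr_deriv ?_
  -- The trace of the evolution equation gives `R + k² + 4πS - 12πρ`; the constraint eliminates `R +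
  -- k²`.
  have hc := h.hamiltonian_constraint t ht
  simp only [scalarCurv, normSq, meanCurv, mixed, stressTrace] at hc ⊢
  simp only [Matrix.mul_sub, Matrix.mul_add, Matrix.mul_smul, Matrix.trace_sub, Matrix.trace_add,
    Matrix.trace_smul, Matrix.smul_mul, Matrix.nonsing_inv_mul _ hu, smul_eq_mul,
    Matrix.trace_one, Fintype.card_fin, ← mul_assoc] at hc ⊢
  push_cast
  linarith

theorem meanCurv_eq (g k : Mat) : meanCurv g k = -3 * hubble g k := by
  rw [hubble]; ring

theorem normSq_traceless {g k : Mat} (hg : g.PosDef) :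
    normSq g (k + hubble g k • g) = normSq g k - 3 * hubble g k ^ 2 := by
  have hu : IsUnit g.det := hg.det_pos.ne'.isUnit
  have h := meanCurv_eq g k
  simp only [normSq, mixed, meanCurv] at h ⊢
  simp only [Matrix.mul_add, Matrix.add_mul, Matrix.mul_smul, Matrix.smul_mul,
    Matrix.nonsing_inv_mul _ hu, Matrix.trace_add, Matrix.trace_smul, smul_eq_mul,
    Matrix.trace_one, Fintype.card_fin, one_mul, mul_one, h]
  push_cast
  ring

theorem traceless_symm {g k : Mat} (hg : gᵀ = g) (hk : kᵀ = k) (c : ℝ) :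
    (k + c • g)ᵀ = k + c • g := by
  simp [hg, hk]

theorem contract_eq {g : Mat} (k : Mat) (hg : g.PosDef) (c : ℝ) :
    g⁻¹ * k * g⁻¹ = g⁻¹ * (k + c • g) * g⁻¹ - c • g⁻¹ := by
  have hu : IsUnit g.det := hg.det_pos.ne'.isUnit
  simp [Matrix.mul_add, Matrix.add_mul, Matrix.nonsing_inv_mul _ hu]

theorem IsSolution.hasDerivWithinAt_hubble (h : IsSolution t₀ g k f) {t : ℝ}
    (ht : t ∈ Ici t₀) :
    HasDerivWithinAt (fun r => hubble (g r) (k r))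
      (-(1 / 3) * (normSq (g t) (k t + hubble (g t) (k t) • g t) + 3 * hubble (g t) (k t) ^ 2
        + 4 * Real.pi * (rho (g t) (f t) + stressTrace (g t) (f t)))) (Ici t₀) t := by
  refine ((h.hasDerivWithinAt_meanCurv ht).const_mul (-(1 / 3))).congr_deriv ?_
  rw [normSq_traceless (h.metric_posDef t ht)]
  ring

theorem IsSolution.hamiltonian (h : IsSolution t₀ g k f) {t : ℝ} (ht : t ∈ Ici t₀) :
    6 * hubble (g t) (k t) ^ 2 - 6 * (g t)⁻¹ 0 0
      = normSq (g t) (k t + hubble (g t) (k t) • g t) + 16 * Real.pi * rho (g t) (f t) := by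
  have hg := h.metric_posDef t ht
  rw [← h.hamiltonian_constraint t ht, normSq_traceless hg, scalarCurv_eq hg, meanCurv_eq]
  ring

/-- By `divergence_eq` the trace part of `k` drops out and `8π j_b = -3 σ⁰_b`; contraction with
`g^{0b}` leaves the component `σ⁰⁰` that drives `g⁰⁰`. -/
theorem IsSolution.momentum (h : IsSolution t₀ g k f) {t : ℝ} (ht : t ∈ Ici t₀) :
    3 * ((g t)⁻¹ * (k t + hubble (g t) (k t) • g t) * (g t)⁻¹) 0 0
      = -8 * Real.pi * ∑ b, (g t)⁻¹ 0 b * current (g t) (f t) b := by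
  have hg := h.metric_posDef t ht
  have hu : IsUnit (g t).det := hg.det_pos.ne'.isUnit
  have hi : ((g t)⁻¹)ᵀ = (g t)⁻¹ := by rw [Matrix.transpose_nonsing_inv, h.metric_symm ht]
  have h1 : ∀ b, 8 * Real.pi * current (g t) (f t) b
      = -3 * ((g t)⁻¹ * (k t + hubble (g t) (k t) • g t)) 0 b := fun b => by
    rw [← h.momentum_constraint t ht, divergence_eq hg (h.second_symm ht), meanCurv_eq,
      Matrix.mul_add, Matrix.mul_smul, Matrix.nonsing_inv_mul _ hu]
    fin_cases b
    · simp [aVec]; ring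
    all_goals simp [aVec]
  have h2 : -8 * Real.pi * ∑ b, (g t)⁻¹ 0 b * current (g t) (f t) b
      = -∑ b, (g t)⁻¹ 0 b * (8 * Real.pi * current (g t) (f t) b) := by
    rw [Finset.mul_sum, ← Finset.sum_neg_distrib]
    exact Finset.sum_congr rfl fun b _ => by ring
  rw [h2, Matrix.mul_apply, Finset.mul_sum, ← Finset.sum_neg_distrib]
  refine Finset.sum_congr rfl fun b _ => ?_
  rw [h1, ← Matrix.transpose_apply (g t)⁻¹ 0 b, hi]
  ring

/-! ### Momentum integrals -/

theorem continuous_quadForm (A : Mat) : Continuous fun p : Vec => p ⬝ᵥ (A *ᵥ p) := by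
  fun_prop

theorem continuous_energy (g : Mat) : Continuous (energy g) :=
  (continuous_const.add (continuous_quadForm _)).sqrt

theorem one_le_energy {g : Mat} (hg : g.PosDef) (p : Vec) : 1 ≤ energy g p :=
  Real.one_le_sqrt.2 (by linarith [quadForm_inv_nonneg hg p])

theorem energy_sq {g : Mat} (hg : g.PosDef) (p : Vec) :
    energy g p ^ 2 = 1 + p ⬝ᵥ (g⁻¹ *ᵥ p) :=
  Real.sq_sqrt (by linarith [quadForm_inv_nonneg hg p])

theorem integrable_momentum {g : Mat} (hg : g.PosDef) {F : Vec → ℝ} (hF : Continuous F)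
    (hc : HasCompactSupport F) : Integrable fun v : Vec => F (g *ᵥ v) * √g.det := by
  have hu : IsUnit g.det := hg.det_pos.ne'.isUnit
  let E : Vec ≃ₜ Vec :=
    { toFun := fun v => g *ᵥ v
      invFun := fun v => g⁻¹ *ᵥ v
      left_inv := fun v => by simp [Matrix.nonsing_inv_mul _ hu]
      right_inv := fun v => by simp [Matrix.mul_nonsing_inv _ hu]
      continuous_toFun := by fun_prop
      continuous_invFun := by fun_prop }
  exact ((hF.comp E.continuous).integrable_of_hasCompactSupport
    (hc.comp_homeomorph E)).mul_const _

theorem momentumIntegral_sum {ι : Type*} (s : Finset ι) {g : Mat} (hg : g.PosDef)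
    {F : ι → Vec → ℝ} (hF : ∀ i, Continuous (F i)) (hc : ∀ i, HasCompactSupport (F i)) :
    momentumIntegral g (fun p => ∑ i ∈ s, F i p) = ∑ i ∈ s, momentumIntegral g (F i) := by
  simp only [momentumIntegral, Finset.sum_mul]
  exact integral_finsetSum _ fun i _ => integrable_momentum hg (hF i) (hc i)

theorem momentumIntegral_const_mul (g : Mat) (c : ℝ) (F : Vec → ℝ) :
    momentumIntegral g (fun p => c * F p) = c * momentumIntegral g F := by
  simp only [momentumIntegral, mul_assoc]
  exact integral_const_mul _ _

theorem momentumIntegral_nonneg {g : Mat} {F : Vec → ℝ} (hF : ∀ p, 0 ≤ F p) :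
    0 ≤ momentumIntegral g F :=
  integral_nonneg fun _ => mul_nonneg (hF _) (Real.sqrt_nonneg _)

theorem abs_momentumIntegral_le_of_abs_le {g : Mat} (hg : g.PosDef) {F G : Vec → ℝ}
    (hG : Continuous G) (hc : HasCompactSupport G) (h : ∀ p, |F p| ≤ G p) :
    |momentumIntegral g F| ≤ momentumIntegral g G := by
  rw [← Real.norm_eq_abs, momentumIntegral, momentumIntegral]
  refine norm_integral_le_of_norm_le (integrable_momentum hg hG hc) (ae_of_all _ fun v => ?_)
  rw [Real.norm_eq_abs, abs_mul, abs_of_nonneg (Real.sqrt_nonneg _)]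
  gcongr
  exact h _

/-- The momentum integral of a bounded function supported in the ball `|p|² ≤ W`. -/
theorem abs_momentumIntegral_le {g : Mat} (hg : g.PosDef) {F : Vec → ℝ} {C W : ℝ}
    (hC : ∀ p, |F p| ≤ C) (hF : ∀ p, F p ≠ 0 → p ⬝ᵥ (g⁻¹ *ᵥ p) ≤ W) :
    |momentumIntegral g F| ≤ C * (8 * √W ^ 3) := by
  obtain ⟨e, he⟩ := exists_orthonormal hg
  have hdet : (eᵀ * g).det ^ 2 = g.det := by
    have h1 : e.det * g.det * e.det = 1 := by
      simpa only [Matrix.det_mul, Matrix.det_transpose, Matrix.det_one] using congrArg Matrix.det he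
    rw [Matrix.det_mul, Matrix.det_transpose]
    linear_combination g.det * h1
  have hsqrt : √g.det = |(eᵀ * g).det| := by rw [← hdet, Real.sqrt_sq_eq_abs]
  have hne : (eᵀ * g).det ≠ 0 := fun h => hg.det_pos.ne' (by rw [← hdet, h]; simp)
  -- In orthonormal components the ball lies in a cube of volume `8 √W³`; the Jacobian of the
  -- passage to these components cancels `√(det g)`.
  set B : Set Vec := Icc (fun _ => -√W) (fun _ => √W) with hB
  set S : Set Vec := Matrix.toLin' (eᵀ * g) ⁻¹' B with hS
  have hdet' : LinearMap.det (Matrix.toLin' (eᵀ * g)) = (eᵀ * g).det := LinearMap.det_toLin' _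
  have hvol : volume S = ENNReal.ofReal |(eᵀ * g).det⁻¹| * volume B := by
    rw [hS, Measure.addHaar_preimage_linearMap _ (by rwa [hdet']), hdet']
  have hvolB : volume B = ENNReal.ofReal (8 * √W ^ 3) := by
    rw [hB, Real.volume_Icc_pi, Fin.prod_univ_three]
    have : 0 ≤ √W - -√W := by linarith [Real.sqrt_nonneg W]
    rw [← ENNReal.ofReal_mul this, ← ENNReal.ofReal_mul (by positivity)]
    ring_nf
  have hmem : ∀ v : Vec, F (g *ᵥ v) ≠ 0 → v ∈ S := by
    intro v hv
    have h1 := hF _ hv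
    rw [quadForm_inv_eq he, Matrix.mulVec_mulVec] at h1
    have h2 : ∀ i, |((eᵀ * g) *ᵥ v) i| ≤ √W := fun i => by
      apply Real.abs_le_sqrt
      refine le_trans ?_ h1
      rw [sq, dotProduct]
      exact Finset.single_le_sum (f := fun i => ((eᵀ * g) *ᵥ v) i * ((eᵀ * g) *ᵥ v) i)
        (fun j _ => mul_self_nonneg _) (Finset.mem_univ i)
    rw [hS, mem_preimage, Matrix.toLin'_apply]
    exact ⟨fun i => (abs_le.1 (h2 i)).1, fun i => (abs_le.1 (h2 i)).2⟩
  have hint : momentumIntegral g F = ∫ v in S, F (g *ᵥ v) * √g.det := by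
    refine (setIntegral_eq_integral_of_forall_compl_eq_zero fun v hv => ?_).symm
    rw [not_ne_iff.1 (mt (hmem v) hv), zero_mul]
  have hlt : volume S < ⊤ := by
    rw [hvol, hvolB]
    exact ENNReal.mul_lt_top ENNReal.ofReal_lt_top ENNReal.ofReal_lt_top
  have hle := norm_setIntegral_le_of_norm_le_const (μ := volume) (s := S)
    (f := fun v => F (g *ᵥ v) * √g.det) (C := C * √g.det) hlt fun v _ => by
      rw [Real.norm_eq_abs, abs_mul, abs_of_nonneg (Real.sqrt_nonneg _)]
      gcongr
      exact hC _
  rw [← hint, Real.norm_eq_abs] at hle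
  refine hle.trans_eq ?_
  rw [Measure.real, hvol, hvolB, ENNReal.toReal_mul, ENNReal.toReal_ofReal (abs_nonneg _),
    ENNReal.toReal_ofReal (by positivity), hsqrt, abs_inv]
  field_simp

/-! ### Signs and sizes of the matter quantities -/

section Matter

variable {g : Mat} {f : Vec → ℝ}

theorem rho_nonneg (hf0 : ∀ p, 0 ≤ f p) : 0 ≤ rho g f :=
  momentumIntegral_nonneg fun p => mul_nonneg (hf0 p) (Real.sqrt_nonneg _)

theorem sum_mul_current (hg : g.PosDef) (hf : Continuous f) (hc : HasCompactSupport f) (c : Vec) :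
    ∑ a, c a * current g f a = momentumIntegral g fun p => f p * (c ⬝ᵥ p) := by
  simp only [current, ← momentumIntegral_const_mul]
  rw [← momentumIntegral_sum _ hg (F := fun a p => c a * (f p * p a)) (fun a => by fun_prop)
    (fun a => hc.mul_right.mul_left)]
  congr 1
  ext p
  rw [dotProduct, Finset.mul_sum]
  exact Finset.sum_congr rfl fun a _ => by ring

theorem sum_mul_stress (hg : g.PosDef) (hf : Continuous f) (hc : HasCompactSupport f)
    (c : Fin 3 → Fin 3 → ℝ) :
    ∑ a, ∑ b, c a b * stress g f a b
      = momentumIntegral g fun p => f p * (∑ a, ∑ b, c a b * (p a * p b)) * (energy g p)⁻¹ := by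
  have he : Continuous fun p => (energy g p)⁻¹ :=
    (continuous_energy g).inv₀ fun p => (zero_lt_one.trans_le (one_le_energy hg p)).ne'
  simp only [stress, Matrix.of_apply, ← momentumIntegral_const_mul]
  have h1 : ∀ a b, Continuous fun p => c a b * (f p * (p a * p b) * (energy g p)⁻¹) :=
    fun a b => by fun_prop
  have h2 : ∀ a b, HasCompactSupport fun p => c a b * (f p * (p a * p b) * (energy g p)⁻¹) :=
    fun a b => hc.mul_right.mul_right.mul_left
  have hprod : ∀ F : Fin 3 → Fin 3 → ℝ, ∑ a, ∑ b, F a b = ∑ x : Fin 3 × Fin 3, F x.1 x.2 :=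
    fun F => (Fintype.sum_prod_type' F).symm
  simp only [hprod]
  rw [← momentumIntegral_sum _ hg (F := fun (x : Fin 3 × Fin 3) p =>
    c x.1 x.2 * (f p * (p x.1 * p x.2) * (energy g p)⁻¹)) (fun x => h1 _ _) (fun x => h2 _ _)]
  congr 1
  ext p
  rw [Finset.mul_sum, Finset.sum_mul]
  exact Finset.sum_congr rfl fun a _ => by ring

theorem stressTrace_eq (hg : g.PosDef) (hf : Continuous f) (hc : HasCompactSupport f) :
    stressTrace g f
      = momentumIntegral g fun p => f p * (p ⬝ᵥ (g⁻¹ *ᵥ p)) * (energy g p)⁻¹ := by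
  have hs : gᵀ = g := by simpa using hg.isHermitian.eq
  have hi : g⁻¹ᵀ = g⁻¹ := by rw [Matrix.transpose_nonsing_inv, hs]
  have h := sum_mul_stress hg hf hc (fun a b => g⁻¹ b a)
  have h1 : ∀ p : Vec, ∑ a, ∑ b, g⁻¹ b a * (p a * p b) = p ⬝ᵥ (g⁻¹ *ᵥ p) := fun p => by
    simp only [dotProduct, Matrix.mulVec, Finset.mul_sum]
    rw [Finset.sum_comm]
    exact Finset.sum_congr rfl fun a _ => Finset.sum_congr rfl fun b _ => by ring
  simp only [h1] at h
  rw [← h, stressTrace, Matrix.trace, Finset.sum_comm]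
  exact Finset.sum_congr rfl fun a _ => by rw [Matrix.diag_apply, Matrix.mul_apply]

theorem stressTrace_nonneg (hg : g.PosDef) (hf : Continuous f) (hc : HasCompactSupport f)
    (hf0 : ∀ p, 0 ≤ f p) : 0 ≤ stressTrace g f := by
  rw [stressTrace_eq hg hf hc]
  exact momentumIntegral_nonneg fun p =>
    mul_nonneg (mul_nonneg (hf0 p) (quadForm_inv_nonneg hg p)) (inv_nonneg.2 (Real.sqrt_nonneg _))

theorem stressTrace_le_rho (hg : g.PosDef) (hf : Continuous f) (hc : HasCompactSupport f)
    (hf0 : ∀ p, 0 ≤ f p) : stressTrace g f ≤ rho g f := by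
  rw [stressTrace_eq hg hf hc]
  refine (le_abs_self _).trans (abs_momentumIntegral_le_of_abs_le hg
    (hf.mul (continuous_energy g)) hc.mul_right fun p => ?_)
  have h1 := one_le_energy hg p
  have h2 := quadForm_inv_nonneg hg p
  rw [abs_of_nonneg (by have := hf0 p; positivity), mul_assoc]
  refine mul_le_mul_of_nonneg_left ?_ (hf0 p)
  rw [← div_eq_mul_inv, div_le_iff₀ (by positivity), ← sq, energy_sq hg]
  linarith

/-- `|c^a j_a| ≤ |c| P ρ`. -/
theorem abs_sum_inv_mul_current_le (hg : g.PosDef) (hf : Continuous f)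
    (hc : HasCompactSupport f) (hf0 : ∀ p, 0 ≤ f p) {W : ℝ}
    (hW : ∀ p, f p ≠ 0 → p ⬝ᵥ (g⁻¹ *ᵥ p) ≤ W) :
    |∑ b, g⁻¹ 0 b * current g f b| ≤ √(g⁻¹ 0 0) * √W * rho g f := by
  rw [sum_mul_current hg hf hc (fun b => g⁻¹ 0 b), rho, ← momentumIntegral_const_mul]
  refine abs_momentumIntegral_le_of_abs_le hg
    (continuous_const.mul (hf.mul (continuous_energy g))) hc.mul_right.mul_left fun p => ?_
  by_cases hp : f p = 0
  · simp [hp]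
  have hN := quadForm_inv_nonneg hg p
  have hcs := sq_quadForm_inv_le hg (Pi.single 0 1) p
  have h0 : 0 ≤ g⁻¹ 0 0 := by simpa using quadForm_inv_nonneg hg (Pi.single 0 1)
  have h1 : |(fun b => g⁻¹ 0 b) ⬝ᵥ p| ≤ √(g⁻¹ 0 0) * √W := by
    rw [← Real.sqrt_mul h0]
    apply Real.abs_le_sqrt
    have h2 : (fun b => g⁻¹ 0 b) ⬝ᵥ p = Pi.single 0 1 ⬝ᵥ (g⁻¹ *ᵥ p) := by
      simp [Matrix.mulVec]
    rw [h2]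
    refine hcs.trans ?_
    simpa using mul_le_mul_of_nonneg_left (hW p hp) h0
  rw [abs_mul, abs_of_nonneg (hf0 p), mul_comm, mul_comm (f p) (energy g p), ← mul_assoc]
  refine mul_le_mul_of_nonneg_right (h1.trans ?_) (hf0 p)
  exact le_mul_of_one_le_right (by positivity) (one_le_energy hg p)

variable {C W : ℝ}

theorem rho_le (hg : g.PosDef) (hC : ∀ p, |f p| ≤ C)
    (hW : ∀ p, f p ≠ 0 → p ⬝ᵥ (g⁻¹ *ᵥ p) ≤ W) :
    |rho g f| ≤ C * √(1 + W) * (8 * √W ^ 3) := by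
  have hC0 : 0 ≤ C := (abs_nonneg _).trans (hC 0)
  refine abs_momentumIntegral_le hg (fun p => ?_) (fun p hp => hW p (left_ne_zero_of_mul hp))
  by_cases hp : f p = 0
  · rw [hp]; simp; positivity
  rw [abs_mul, abs_of_nonneg (zero_le_one.trans (one_le_energy hg p))]
  exact mul_le_mul (hC p) (Real.sqrt_le_sqrt (by linarith [hW p hp])) (Real.sqrt_nonneg _) hC0

theorem abs_frame_le {e : Mat} (he : eᵀ * g * e = 1) {p : Vec}
    (hp : p ⬝ᵥ (g⁻¹ *ᵥ p) ≤ W) (i : Fin 3) : |(eᵀ *ᵥ p) i| ≤ √W := by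
  apply Real.abs_le_sqrt
  rw [quadForm_inv_eq he] at hp
  refine le_trans ?_ hp
  rw [sq, dotProduct]
  exact Finset.single_le_sum (f := fun i => (eᵀ *ᵥ p) i * (eᵀ *ᵥ p) i)
    (fun j _ => mul_self_nonneg _) (Finset.mem_univ i)

theorem frameVec_current_le (hg : g.PosDef) (hf : Continuous f) (hc : HasCompactSupport f)
    (hC : ∀ p, |f p| ≤ C) (hW : ∀ p, f p ≠ 0 → p ⬝ᵥ (g⁻¹ *ᵥ p) ≤ W)
    {e : Mat} (he : eᵀ * g * e = 1) (i : Fin 3) :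
    |frameVec e (current g f) i| ≤ C * √W * (8 * √W ^ 3) := by
  have hC0 : 0 ≤ C := (abs_nonneg _).trans (hC 0)
  have h : frameVec e (current g f) i = momentumIntegral g fun p => f p * (eᵀ *ᵥ p) i :=
    sum_mul_current hg hf hc (eᵀ i)
  rw [h]
  refine abs_momentumIntegral_le hg (fun p => ?_) (fun p hp => hW p (left_ne_zero_of_mul hp))
  by_cases hp : f p = 0
  · rw [hp]; simp; positivity
  rw [abs_mul]
  exact mul_le_mul (hC p) (abs_frame_le he (hW p hp) i) (abs_nonneg _) hC0

theorem frameMat_stress_le (hg : g.PosDef) (hf : Continuous f) (hc : HasCompactSupport f)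
    (hC : ∀ p, |f p| ≤ C) (hW : ∀ p, f p ≠ 0 → p ⬝ᵥ (g⁻¹ *ᵥ p) ≤ W)
    {e : Mat} (he : eᵀ * g * e = 1) (i j : Fin 3) :
    |frameMat e (stress g f) i j| ≤ C * (√W * √W) * (8 * √W ^ 3) := by
  have hC0 : 0 ≤ C := (abs_nonneg _).trans (hC 0)
  have h1 : frameMat e (stress g f) i j = ∑ a, ∑ b, (e a i * e b j) * stress g f a b := by
    simp only [frameMat, Matrix.mul_apply, Matrix.transpose_apply, Finset.sum_mul]
    rw [Finset.sum_comm]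
    exact Finset.sum_congr rfl fun a _ => Finset.sum_congr rfl fun b _ => by ring
  have h2 : ∀ p : Vec, ∑ a, ∑ b, (e a i * e b j) * (p a * p b)
      = (eᵀ *ᵥ p) i * (eᵀ *ᵥ p) j := fun p => by
    simp only [Matrix.mulVec, dotProduct, Finset.sum_mul_sum, Matrix.transpose_apply]
    exact Finset.sum_congr rfl fun a _ => Finset.sum_congr rfl fun b _ => by ring
  rw [h1, sum_mul_stress hg hf hc]
  simp only [h2]
  refine abs_momentumIntegral_le hg (fun p => ?_)
    (fun p hp => hW p (left_ne_zero_of_mul (left_ne_zero_of_mul hp)))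
  by_cases hp : f p = 0
  · rw [hp]; simp; positivity
  have he1 := one_le_energy hg p
  rw [abs_mul, abs_mul, abs_mul, abs_of_nonneg (by positivity : 0 ≤ (energy g p)⁻¹)]
  refine (mul_le_of_le_one_right (by positivity) (inv_le_one_of_one_le₀ he1)).trans ?_
  exact mul_le_mul (hC p) (mul_le_mul (abs_frame_le he (hW p hp) i) (abs_frame_le he (hW p hp) j)
    (abs_nonneg _) (Real.sqrt_nonneg _)) (by positivity) hC0

end Matter

/-! ### The transport equation -/

/-- `d` is the value at `(t, p)` of `∂_t u + X^a ∂u/∂p_a`. -/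
def HasTransportDeriv (t₀ : ℝ) (X : ℝ → Vec → Vec) (u : ℝ → Vec → ℝ) (t : ℝ) (p : Vec)
    (d : ℝ) : Prop :=
  ∃ (ut : ℝ) (L : Vec →L[ℝ] ℝ), HasDerivWithinAt (fun s => u s p) ut (Ici t₀) t ∧
    HasFDerivAt (u t) L p ∧ ut + L (X t p) = d

section Transport

variable {t₀ : ℝ} {X : ℝ → Vec → Vec} {u v : ℝ → Vec → ℝ} {t : ℝ} {p : Vec} {d d' : ℝ}

theorem HasTransportDeriv.mul (hu : HasTransportDeriv t₀ X u t p d)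
    (hv : HasTransportDeriv t₀ X v t p d') :
    HasTransportDeriv t₀ X (fun s q => u s q * v s q) t p (d * v t p + u t p * d') := by
  obtain ⟨a, L, h1, h2, h3⟩ := hu
  obtain ⟨b, M, h4, h5, h6⟩ := hv
  refine ⟨_, _, h1.mul h4, h2.mul h5, ?_⟩
  subst h3 h6
  simp
  ring

theorem HasTransportDeriv.sub (hu : HasTransportDeriv t₀ X u t p d)
    (hv : HasTransportDeriv t₀ X v t p d') :
    HasTransportDeriv t₀ X (fun s q => u s q - v s q) t p (d - d') := by
  obtain ⟨a, L, h1, h2, h3⟩ := hu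
  obtain ⟨b, M, h4, h5, h6⟩ := hv
  refine ⟨_, _, h1.sub h4, h2.sub h5, ?_⟩
  subst h3 h6
  simp
  ring

theorem HasTransportDeriv.comp {φ : ℝ → ℝ} {φ' : ℝ} (hφ : HasDerivAt φ φ' (u t p))
    (hu : HasTransportDeriv t₀ X u t p d) :
    HasTransportDeriv t₀ X (fun s q => φ (u s q)) t p (φ' * d) := by
  obtain ⟨a, L, h1, h2, h3⟩ := hu
  refine ⟨_, _, hφ.comp_hasDerivWithinAt t h1, hφ.comp_hasFDerivAt p h2, ?_⟩
  subst h3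
  simp
  ring

theorem hasTransportDeriv_time {h : ℝ → ℝ} {h' : ℝ} (hh : HasDerivWithinAt h h' (Ici t₀) t) :
    HasTransportDeriv t₀ X (fun s _ => h s) t p h' :=
  ⟨h', 0, hh, hasFDerivAt_const _ _, by simp⟩

theorem hasDerivWithinAt_nonneg_of_max {w : ℝ → ℝ} {a : ℝ} (ht : t₀ < t)
    (hw : HasDerivWithinAt w a (Ici t₀) t) (hmax : ∀ s ∈ Icc t₀ t, w s ≤ w t) : 0 ≤ a := by
  have h1 : HasDerivWithinAt w a (Iio t) t :=
    hw.mono_of_mem_nhdsWithin (mem_nhdsWithin_of_mem_nhds (Ici_mem_nhds ht))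
  have h2 := (hasDerivWithinAt_iff_tendsto_slope' (by simp)).1 h1
  refine ge_of_tendsto h2 ?_
  filter_upwards [Ioo_mem_nhdsLT ht] with s hs
  rw [slope_def_field]
  exact div_nonneg_of_nonpos (by linarith [hmax s ⟨hs.1.le, hs.2.le⟩]) (by linarith [hs.2])

/-- Maximum principle: a subsolution of the transport equation that is nonpositive initially and
does not grow faster than the coercive function `1 + N` stays nonpositive. -/
theorem transport_max_principle {N : ℝ → Vec → ℝ} {DN Du : ℝ → Vec → ℝ} {T B M : ℝ}
    (hT : t₀ ≤ T)
    (hNcont : ContinuousOn (fun x : ℝ × Vec => N x.1 x.2) (Ici t₀ ×ˢ univ))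
    (hucont : ContinuousOn (fun x : ℝ × Vec => u x.1 x.2) (Ici t₀ ×ˢ univ))
    (hN0 : ∀ t ∈ Icc t₀ T, ∀ p, 0 ≤ N t p)
    (hcoer : ∀ R, ∃ r, ∀ t ∈ Icc t₀ T, ∀ p, N t p ≤ R → ‖p‖ ≤ r)
    (hN : ∀ t ∈ Icc t₀ T, ∀ p, HasTransportDeriv t₀ X N t p (DN t p))
    (hM0 : 0 ≤ M) (hM : ∀ t ∈ Icc t₀ T, ∀ p, -M * N t p ≤ DN t p)
    (hu : ∀ t ∈ Icc t₀ T, ∀ p, HasTransportDeriv t₀ X u t p (Du t p))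
    (hDu : ∀ t ∈ Icc t₀ T, ∀ p, Du t p ≤ 0)
    (hB : ∀ t ∈ Icc t₀ T, ∀ p, u t p ≤ B * (1 + N t p))
    (h₀ : ∀ p, u t₀ p ≤ 0) (q : Vec) : u T q ≤ 0 := by
  by_contra! hpos
  have hTmem : T ∈ Icc t₀ T := ⟨hT, le_rfl⟩
  -- The square outgrows the linear bound on `u`, which confines the points where `w > 0` to a
  -- bounded set. The exponent beats the loss `-2 M N (1 + N)` from transporting `(1 + N)²`, so `φ`
  -- is a strict supersolution.
  set φ : ℝ → Vec → ℝ := fun t p => Real.exp ((2 * M + 1) * (t - t₀)) * (1 + N t p) ^ 2 with hφ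
  have hφpos : ∀ t ∈ Icc t₀ T, ∀ p, 0 < φ t p := fun t ht p => by
    have := hN0 t ht p
    positivity
  obtain ⟨δ, hδ, hδq⟩ : ∃ δ, 0 < δ ∧ 0 < u T q - δ * φ T q := by
    have := hφpos T hTmem q
    refine ⟨u T q / (2 * φ T q), by positivity, ?_⟩
    rw [div_mul_eq_mul_div, mul_div_mul_right _ _ this.ne']
    linarith
  set w : ℝ → Vec → ℝ := fun t p => u t p - δ * φ t p with hw
  obtain ⟨r, hr⟩ := hcoer (B / δ)
  have hbound : ∀ t ∈ Icc t₀ T, ∀ p, 0 < w t p → ‖p‖ ≤ r := by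
    intro t ht p hp
    apply hr t ht p
    have h1 := hB t ht p
    have h2 := hN0 t ht p
    have h3 : δ * (1 + N t p) ^ 2 ≤ δ * φ t p := by
      refine mul_le_mul_of_nonneg_left (le_mul_of_one_le_left (by positivity) ?_) hδ.le
      exact Real.one_le_exp (mul_nonneg (by linarith) (by linarith [ht.1]))
    have h4 : δ * (1 + N t p) * (1 + N t p) < B * (1 + N t p) := by
      simp only [hw] at hp
      nlinarith
    have h5 := lt_of_mul_lt_mul_right h4 (by linarith)
    rw [le_div_iff₀ hδ]
    nlinarith
  have hwcont : ContinuousOn (fun x : ℝ × Vec => w x.1 x.2) (Ici t₀ ×ˢ univ) := by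
    refine hucont.sub (continuousOn_const.mul (ContinuousOn.mul ?_ ?_))
    · exact Continuous.continuousOn (by fun_prop)
    · exact (continuousOn_const.add hNcont).pow 2
  -- Radius `r + 1` rather than `r`: the maximum point has `‖p‖ ≤ r`, so it is interior in `p` and
  -- the momentum derivative of `w` vanishes there.
  obtain ⟨⟨t, p⟩, ⟨ht, -⟩, hmax⟩ := (isCompact_Icc.prod (isCompact_closedBall (0 : Vec) (r + 1))
    ).exists_isMaxOn ⟨(T, q), hTmem, by
      simpa using (hbound T hTmem q hδq).trans (by linarith)⟩
    (hwcont.mono (prod_mono Icc_subset_Ici_self (subset_univ _)))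
  have hmax' : ∀ s ∈ Icc t₀ T, ∀ p' : Vec, ‖p'‖ ≤ r + 1 → w s p' ≤ w t p := fun s hs p' hp' =>
    hmax (a := (s, p')) ⟨hs, by simpa using hp'⟩
  have hwpos : 0 < w t p :=
    hδq.trans_le (hmax' T hTmem q ((hbound T hTmem q hδq).trans (by linarith)))
  have hpr : ‖p‖ ≤ r := hbound t ht p hwpos
  have htne : t₀ < t := by
    refine lt_of_le_of_ne ht.1 fun h => ?_
    subst h
    have := h₀ p
    have := mul_pos hδ (hφpos t₀ ht p)
    simp only [hw] at hwpos
    linarith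
  have hφd : HasTransportDeriv t₀ X φ t p
      (((2 * M + 1) * Real.exp ((2 * M + 1) * (t - t₀))) * (1 + N t p) ^ 2
        + Real.exp ((2 * M + 1) * (t - t₀)) * (2 * (1 + N t p) * DN t p)) := by
    have h1 : HasDerivAt (fun s => Real.exp ((2 * M + 1) * (s - t₀)))
        ((2 * M + 1) * Real.exp ((2 * M + 1) * (t - t₀))) t := by
      have := (((hasDerivAt_id t).sub_const t₀).const_mul (2 * M + 1)).exp
      simpa [mul_comm] using this
    have h2 : HasDerivAt (fun x : ℝ => (1 + x) ^ 2) (2 * (1 + N t p)) (N t p) := by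
      simpa using ((hasDerivAt_id (N t p)).const_add 1).fun_pow 2
    exact (hasTransportDeriv_time h1.hasDerivWithinAt).mul ((hN t ht p).comp h2)
  obtain ⟨a, L, h1, h2, h3⟩ : HasTransportDeriv t₀ X w t p _ :=
    (hu t ht p).sub ((hasTransportDeriv_time (hasDerivWithinAt_const t (Ici t₀) δ)).mul hφd)
  have ha : 0 ≤ a := hasDerivWithinAt_nonneg_of_max htne h1 fun s hs =>
    hmax' s ⟨hs.1, hs.2.trans ht.2⟩ p (by linarith)
  have hL : L = 0 := by
    refine IsLocalMax.hasFDerivAt_eq_zero (f := w t) ?_ h2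
    filter_upwards [Metric.ball_mem_nhds p one_pos] with p' hp'
    apply hmax' t ht
    rw [mem_ball_iff_norm] at hp'
    linarith [norm_le_norm_add_norm_sub' p' p]
  rw [hL] at h3
  simp only [zero_apply, add_zero, zero_mul, zero_add] at h3
  have h4 := hDu t ht p
  have h5 := hM t ht p
  have h6 := hN0 t ht p
  have h7 : 0 < (2 * M + 1) * Real.exp ((2 * M + 1) * (t - t₀)) * (1 + N t p) ^ 2
      + Real.exp ((2 * M + 1) * (t - t₀)) * (2 * (1 + N t p) * DN t p) := by
    have : (2 * M + 1) * Real.exp ((2 * M + 1) * (t - t₀)) * (1 + N t p) ^ 2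
      + Real.exp ((2 * M + 1) * (t - t₀)) * (2 * (1 + N t p) * DN t p)
      = Real.exp ((2 * M + 1) * (t - t₀)) * (1 + N t p) *
        (1 + N t p + 2 * M + 2 * (M * N t p + DN t p)) := by ring
    rw [this]
    have : 0 ≤ M * N t p + DN t p := by linarith
    positivity
  have := mul_pos hδ h7
  linarith

end Transport

/-! ### The distribution function -/

/-- `k^{ab} p_a p_b`. -/
def contract (g k : Mat) (p : Vec) : ℝ := p ⬝ᵥ ((g⁻¹ * k * g⁻¹) *ᵥ p)

/-- `C^d_{ba}` is antisymmetric in `b, a`, while `p^b p^a` is symmetric. -/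
theorem inv_mulVec_dotProduct_force (g : Mat) (p : Vec) : (g⁻¹ *ᵥ p) ⬝ᵥ force g p = 0 := by
  generalize hq : g⁻¹ *ᵥ p = q
  simp only [dotProduct, force, hq]
  simp [structConst, Fin.sum_univ_three, aVec, Matrix.one_apply]
  ring

theorem hasFDerivAt_quadForm {A : Mat} (hA : Aᵀ = A) (p : Vec) :
    ∃ L : Vec →L[ℝ] ℝ, HasFDerivAt (fun p : Vec => p ⬝ᵥ (A *ᵥ p)) L p ∧
      ∀ v, L v = 2 * ((A *ᵥ p) ⬝ᵥ v) := by
  have h0 : ∀ i, HasFDerivAt (fun q : Vec => (A *ᵥ q) i)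
      (∑ j, A i j • ContinuousLinearMap.proj (R := ℝ) (φ := fun _ : Fin 3 => ℝ) j) p := fun i => by
    simp only [Matrix.mulVec, dotProduct]
    exact HasFDerivAt.fun_sum fun j _ => (hasFDerivAt_apply j p).const_mul (A i j)
  refine ⟨_, HasFDerivAt.fun_sum fun i _ => (hasFDerivAt_apply i p).mul (h0 i), fun v => ?_⟩
  have h1 : p ⬝ᵥ (A *ᵥ v) = (A *ᵥ p) ⬝ᵥ v := by
    rw [Matrix.dotProduct_mulVec, ← Matrix.mulVec_transpose, hA]
  rw [two_mul]
  nth_rewrite 1 [← h1]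
  simp [dotProduct, Matrix.mulVec, Finset.sum_add_distrib, mul_comm]

section Distribution

variable {t₀ : ℝ} {g k : ℝ → Mat} {f : ℝ → Vec → ℝ}

theorem IsSolution.inv_symm (h : IsSolution t₀ g k f) {t : ℝ} (ht : t ∈ Ici t₀) :
    ((g t)⁻¹)ᵀ = (g t)⁻¹ := by
  rw [Matrix.transpose_nonsing_inv, h.metric_symm ht]

theorem IsSolution.hasTransportDeriv_norm (h : IsSolution t₀ g k f) {t : ℝ} (ht : t ∈ Ici t₀)
    (p : Vec) :
    HasTransportDeriv t₀ (fun t => force (g t)) (fun t p => p ⬝ᵥ ((g t)⁻¹ *ᵥ p)) t p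
      (2 * contract (g t) (k t) p) := by
  obtain ⟨L, h1, h2⟩ := hasFDerivAt_quadForm (h.inv_symm ht) p
  refine ⟨2 * contract (g t) (k t) p, L, ?_, h1, ?_⟩
  · simp only [contract, dotProduct, Matrix.mulVec]
    refine (HasDerivWithinAt.fun_sum fun i _ => (HasDerivWithinAt.fun_sum fun j _ =>
      (h.hasDerivWithinAt_inv ht i j).mul_const (p j)).const_mul (p i)).congr_deriv ?_
    simp only [Finset.mul_sum]
    exact Finset.sum_congr rfl fun a _ => Finset.sum_congr rfl fun b _ => by ring
  · rw [h2, inv_mulVec_dotProduct_force]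
    ring

theorem IsSolution.differentiableAt_distr (h : IsSolution t₀ g k f) {t : ℝ} (ht : t ∈ Ici t₀)
    (p : Vec) : DifferentiableAt ℝ (f t) p := by
  have h1 := (h.distr_smooth.differentiableOn (by simp)) (t, p) ⟨ht, mem_univ p⟩
  have h2 : DifferentiableWithinAt ℝ (fun q : Vec => (t, q)) univ p := by fun_prop
  exact differentiableWithinAt_univ.1
    (h1.comp p h2 fun q _ => (⟨ht, mem_univ q⟩ : (t, q) ∈ Ici t₀ ×ˢ univ))

theorem IsSolution.continuous_distr (h : IsSolution t₀ g k f) {t : ℝ} (ht : t ∈ Ici t₀) :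
    Continuous (f t) :=
  continuous_iff_continuousAt.2 fun p => (h.differentiableAt_distr ht p).continuousAt

theorem IsSolution.hasTransportDeriv_distr (h : IsSolution t₀ g k f) {t : ℝ} (ht : t ∈ Ici t₀)
    (p : Vec) : HasTransportDeriv t₀ (fun t => force (g t)) f t p 0 := by
  have h1 := (h.distr_smooth.differentiableOn (by simp)) (t, p) ⟨ht, mem_univ p⟩
  have h2 : DifferentiableWithinAt ℝ (fun s : ℝ => (s, p)) (Ici t₀) t := by fun_prop
  have h3 : DifferentiableWithinAt ℝ (fun s => f s p) (Ici t₀) t :=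
    DifferentiableWithinAt.comp (g := fun x : ℝ × Vec => f x.1 x.2) t h1 h2 fun s hs => (⟨hs, mem_univ p⟩ : (s, p) ∈ Ici t₀ ×ˢ univ)
  refine ⟨_, _, h3.hasDerivWithinAt, (h.differentiableAt_distr ht p).hasFDerivAt, ?_⟩
  rw [← h.vlasov t ht p]
  congr 1
  have := LinearMap.pi_apply_eq_sum_univ (fderiv ℝ (f t) p).toLinearMap (force (g t) p)
  simp only [ContinuousLinearMap.coe_coe, smul_eq_mul] at this
  rw [this]
  refine Finset.sum_congr rfl fun a _ => ?_
  congr 2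
  ext b
  simp [Pi.single_apply, eq_comm]

theorem IsSolution.continuousOn_metric (h : IsSolution t₀ g k f) : ContinuousOn g (Ici t₀) :=
  continuousOn_pi.2 fun a => continuousOn_pi.2 fun b => (h.metric_smooth a b).continuousOn

theorem IsSolution.continuousOn_second (h : IsSolution t₀ g k f) : ContinuousOn k (Ici t₀) :=
  continuousOn_pi.2 fun a => continuousOn_pi.2 fun b => (h.second_smooth a b).continuousOn

theorem IsSolution.continuousOn_inv (h : IsSolution t₀ g k f) :
    ContinuousOn (fun t => (g t)⁻¹) (Ici t₀) :=
  continuousOn_pi.2 fun a => continuousOn_pi.2 fun b => fun _ ht =>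
    (h.hasDerivWithinAt_inv ht a b).continuousWithinAt

theorem IsSolution.continuousOn_norm (h : IsSolution t₀ g k f) :
    ContinuousOn (fun x : ℝ × Vec => x.2 ⬝ᵥ ((g x.1)⁻¹ *ᵥ x.2)) (Ici t₀ ×ˢ univ) := by
  have h1 : Continuous fun x : Mat × Vec => x.2 ⬝ᵥ (x.1 *ᵥ x.2) := by fun_prop
  have h2 : ContinuousOn (fun x : ℝ × Vec => ((g x.1)⁻¹, x.2)) (Ici t₀ ×ˢ univ) :=
    (h.continuousOn_inv.comp continuousOn_fst fun x hx => hx.1).prodMk continuousOn_snd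
  exact h1.comp_continuousOn h2

theorem IsSolution.continuousOn_hubble (h : IsSolution t₀ g k f) :
    ContinuousOn (fun t => hubble (g t) (k t)) (Ici t₀) :=
  fun _ ht => (h.hasDerivWithinAt_hubble ht).continuousWithinAt

theorem continuousOn_trace_sq {A : ℝ → Mat} {s : Set ℝ} (hA : ContinuousOn A s) :
    ContinuousOn (fun t => (A t * A t).trace) s :=
  continuous_id.matrix_trace.comp_continuousOn (hA.mul hA)

theorem IsSolution.continuousOn_normSq (h : IsSolution t₀ g k f) :
    ContinuousOn (fun t => normSq (g t) (k t + hubble (g t) (k t) • g t)) (Ici t₀) :=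
  ((continuousOn_trace_sq (h.continuousOn_inv.mul h.continuousOn_second)).sub
    (continuousOn_const.mul (h.continuousOn_hubble.pow 2))).congr fun _ ht =>
      normSq_traceless (h.metric_posDef _ ht)

theorem IsSolution.abs_contract_add_le (h : IsSolution t₀ g k f) {t : ℝ} (ht : t ∈ Ici t₀)
    (p : Vec) :
    |contract (g t) (k t) p + hubble (g t) (k t) * (p ⬝ᵥ ((g t)⁻¹ *ᵥ p))|
      ≤ √(normSq (g t) (k t + hubble (g t) (k t) • g t)) * (p ⬝ᵥ ((g t)⁻¹ *ᵥ p)) := by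
  have hg := h.metric_posDef t ht
  have h1 := abs_contract_le hg
    (traceless_symm (h.metric_symm ht) (h.second_symm ht) (hubble (g t) (k t))) p
  rw [contract, contract_eq (k t) hg (hubble (g t) (k t))]
  simpa [Matrix.sub_mulVec, Matrix.smul_mulVec, dotProduct_sub, dotProduct_smul] using h1

theorem IsSolution.exists_norm_le (h : IsSolution t₀ g k f) (T R : ℝ) :
    ∃ r, ∀ t ∈ Icc t₀ T, ∀ p : Vec, p ⬝ᵥ ((g t)⁻¹ *ᵥ p) ≤ R → ‖p‖ ≤ r := by
  have h1 : ContinuousOn (fun t => (g t).trace) (Icc t₀ T) :=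
    (continuous_id.matrix_trace.comp_continuousOn h.continuousOn_metric).mono Icc_subset_Ici_self
  obtain ⟨G, hG⟩ := isCompact_Icc.exists_bound_of_continuousOn h1
  refine ⟨√(G * R), fun t ht p hp => ?_⟩
  have hg := h.metric_posDef t ht.1
  rw [pi_norm_le_iff_of_nonneg (Real.sqrt_nonneg _)]
  intro a
  apply Real.abs_le_sqrt
  have h2 : g t a a ≤ G := by
    refine le_trans ?_ ((le_abs_self _).trans (hG t ht))
    exact Finset.single_le_sum (f := fun i => g t i i) (fun i _ => hg.posSemidef.diag_nonneg)
      (Finset.mem_univ a)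
  have h3 : 0 ≤ g t a a := hg.posSemidef.diag_nonneg
  have h4 := quadForm_inv_nonneg hg p
  exact (sq_apply_le hg p a).trans (mul_le_mul h2 hp h4 (h3.trans h2))

theorem IsSolution.max_principle (h : IsSolution t₀ g k f) {u Du : ℝ → Vec → ℝ} {T B : ℝ}
    (hT : t₀ ≤ T)
    (hucont : ContinuousOn (fun x : ℝ × Vec => u x.1 x.2) (Ici t₀ ×ˢ univ))
    (hu : ∀ t ∈ Icc t₀ T, ∀ p,
      HasTransportDeriv t₀ (fun t => force (g t)) u t p (Du t p))
    (hDu : ∀ t ∈ Icc t₀ T, ∀ p, Du t p ≤ 0)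
    (hB : ∀ t ∈ Icc t₀ T, ∀ p, u t p ≤ B * (1 + p ⬝ᵥ ((g t)⁻¹ *ᵥ p)))
    (h₀ : ∀ p, u t₀ p ≤ 0) (q : Vec) : u T q ≤ 0 := by
  have h1 : ContinuousOn (fun t => 2 * (√(normSq (g t) (k t + hubble (g t) (k t) • g t))
      + hubble (g t) (k t))) (Icc t₀ T) :=
    (continuousOn_const.mul (h.continuousOn_normSq.sqrt.add h.continuousOn_hubble)).mono
      Icc_subset_Ici_self
  obtain ⟨M, hM⟩ := isCompact_Icc.exists_bound_of_continuousOn h1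
  refine transport_max_principle (M := M) hT h.continuousOn_norm hucont
    (fun t ht p => quadForm_inv_nonneg (h.metric_posDef t ht.1) p) (h.exists_norm_le T)
    (fun t ht p => h.hasTransportDeriv_norm ht.1 p)
    ((norm_nonneg _).trans (hM t₀ ⟨le_rfl, hT⟩)) (fun t ht p => ?_) hu hDu hB h₀ q
  have h2 := (abs_le.1 (h.abs_contract_add_le ht.1 p)).1
  have h3 := (le_abs_self _).trans (hM t ht)
  have h4 := quadForm_inv_nonneg (h.metric_posDef t ht.1) p
  nlinarith

theorem IsSolution.distr_le (h : IsSolution t₀ g k f) {C : ℝ} (hC : ∀ p, f t₀ p ≤ C) {T : ℝ}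
    (hT : T ∈ Ici t₀) (q : Vec) : f T q ≤ C := by
  -- A bounded increasing function of `f` is transported as well and meets the growth condition
  -- without any prior uniform bound on `f`.
  have h1 := h.max_principle (u := fun t p => Real.arctan (f t p) - Real.arctan C)
    (Du := fun t p => 1 / (1 + f t p ^ 2) * 0 - 0) (B := Real.pi) hT
    ((Real.continuous_arctan.comp_continuousOn h.distr_smooth.continuousOn).sub
      continuousOn_const)
    (fun t ht p => ((h.hasTransportDeriv_distr ht.1 p).comp (Real.hasDerivAt_arctan _)).sub
      (hasTransportDeriv_time (hasDerivWithinAt_const _ _ _)))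
    (by simp)
    (fun t ht p => by
      have h2 := Real.arctan_lt_pi_div_two (f t p)
      have h3 := Real.neg_pi_div_two_lt_arctan C
      have h4 := quadForm_inv_nonneg (h.metric_posDef t ht.1) p
      nlinarith [Real.pi_pos])
    (fun p => sub_nonpos.2 (Real.arctan_mono (hC p))) q
  exact Real.arctan_strictMono.le_iff_le.1 (sub_nonpos.1 h1)

/-- The momenta in the support of the distribution function are bounded by a solution of the
comparison equation `W' = 2 (|σ| - H) W`. -/
theorem IsSolution.norm_le_of_distr_ne_zero (h : IsSolution t₀ g k f) {W : ℝ → ℝ}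
    (hWpos : ∀ t ∈ Ici t₀, 0 < W t)
    (hW : ∀ t ∈ Ici t₀, HasDerivWithinAt W
      (2 * (√(normSq (g t) (k t + hubble (g t) (k t) • g t)) - hubble (g t) (k t)) * W t)
      (Ici t₀) t)
    (h₀ : ∀ p, f t₀ p ≠ 0 → p ⬝ᵥ ((g t₀)⁻¹ *ᵥ p) ≤ W t₀) {T : ℝ} (hT : T ∈ Ici t₀) (q : Vec)
    (hq : f T q ≠ 0) : q ⬝ᵥ ((g T)⁻¹ *ᵥ q) ≤ W T := by
  have hWc : ContinuousOn W (Ici t₀) := fun t ht => (hW t ht).continuousWithinAt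
  have hWi : ContinuousOn (fun t => (W t)⁻¹) (Ici t₀) :=
    hWc.inv₀ fun t ht => (hWpos t ht).ne'
  obtain ⟨B, hB⟩ := (isCompact_Icc (a := t₀) (b := T)).exists_bound_of_continuousOn
    (hWi.mono Icc_subset_Ici_self)
  have hat : ∀ t ∈ Ici t₀, ∀ p, 0 ≤ Real.arctan (f t p) := fun t ht p =>
    Real.arctan_nonneg.2 (h.distr_nonneg t ht p)
  set l : ℝ → ℝ := fun t =>
    2 * (√(normSq (g t) (k t + hubble (g t) (k t) • g t)) - hubble (g t) (k t)) with hl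
  -- `arctan f` is transported and nonnegative, and `|p|² / W` does not increase along the flow, so
  -- the product stays nonpositive; where `f ≠ 0` this forces `|p|² ≤ W`.
  have h1 := h.max_principle
    (u := fun t p => Real.arctan (f t p) * ((p ⬝ᵥ ((g t)⁻¹ *ᵥ p)) * (W t)⁻¹ - 1))
    (Du := fun t p => 1 / (1 + f t p ^ 2) * 0 * ((p ⬝ᵥ ((g t)⁻¹ *ᵥ p)) * (W t)⁻¹ - 1)
      + Real.arctan (f t p) * ((2 * contract (g t) (k t) p * (W t)⁻¹
        + (p ⬝ᵥ ((g t)⁻¹ *ᵥ p)) * (-(l t * W t) / W t ^ 2)) - 0))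
    (B := Real.pi / 2 * B) hT
    ((Real.continuous_arctan.comp_continuousOn h.distr_smooth.continuousOn).mul
      ((h.continuousOn_norm.mul (hWi.comp continuousOn_fst fun x hx => hx.1)).sub
        continuousOn_const))
    (fun t ht p => ((h.hasTransportDeriv_distr ht.1 p).comp (Real.hasDerivAt_arctan _)).mul
      (((h.hasTransportDeriv_norm ht.1 p).mul
        (hasTransportDeriv_time ((hW t ht.1).inv (hWpos t ht.1).ne'))).sub
        (hasTransportDeriv_time (hasDerivWithinAt_const _ _ _))))
    (fun t ht p => by
      have hw := hWpos t ht.1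
      have h2 := (abs_le.1 (h.abs_contract_add_le ht.1 p)).2
      have h3 : (2 * contract (g t) (k t) p * (W t)⁻¹
        + (p ⬝ᵥ ((g t)⁻¹ *ᵥ p)) * (-(l t * W t) / W t ^ 2))
        = (2 * contract (g t) (k t) p - l t * (p ⬝ᵥ ((g t)⁻¹ *ᵥ p))) * (W t)⁻¹ := by
        field_simp
        ring
      rw [h3, mul_zero, zero_mul, zero_add, sub_zero]
      refine mul_nonpos_of_nonneg_of_nonpos (hat t ht.1 p)
        (mul_nonpos_of_nonpos_of_nonneg ?_ (by positivity))
      simp only [hl]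
      linarith)
    (fun t ht p => by
      have hw := hWpos t ht.1
      have h2 := (Real.arctan_lt_pi_div_two (f t p)).le
      have h4 := quadForm_inv_nonneg (h.metric_posDef t ht.1) p
      have h5 := (le_abs_self _).trans (hB t ht)
      have h6 : 0 < (W t)⁻¹ := by positivity
      have h7 := hat t ht.1 p
      calc _ ≤ Real.arctan (f t p) * ((p ⬝ᵥ ((g t)⁻¹ *ᵥ p)) * (W t)⁻¹) := by
            gcongr; linarith
        _ ≤ Real.pi / 2 * ((p ⬝ᵥ ((g t)⁻¹ *ᵥ p)) * B) := by gcongr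
        _ ≤ _ := by
            have := Real.pi_pos
            nlinarith [mul_pos this (h6.trans_le h5)])
    (fun p => by
      by_cases hp : f t₀ p = 0
      · simp [hp]
      have hw := hWpos t₀ self_mem_Ici
      refine mul_nonpos_of_nonneg_of_nonpos (hat t₀ self_mem_Ici p) ?_
      rw [sub_nonpos, ← div_eq_mul_inv, div_le_one hw]
      exact h₀ p hp) q
  have hfq : 0 < Real.arctan (f T q) :=
    Real.arctan_pos.2 (lt_of_le_of_ne (h.distr_nonneg T hT q) hq.symm)
  have h2 := nonpos_of_mul_nonpos_right h1 hfq
  rwa [sub_nonpos, ← div_eq_mul_inv, div_le_one (hWpos T hT)] at h2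

end Distribution

/-! ### Future asymptotics -/

/-- `1 - A`, the deviation of the curvature variable from its value in the Milne universe. -/
def curvDeviation (g k : Mat) : ℝ := 1 - g⁻¹ 0 0 / hubble g k ^ 2

section Asymptotics

variable {t₀ : ℝ} {g k : ℝ → Mat} {f : ℝ → Vec → ℝ}

theorem curvDeviation_eq {g : Mat} (hg : g.PosDef) (k : Mat) :
    curvDeviation g k = 1 - curvVar g k := by
  rw [curvDeviation, curvVar, scalarCurv_eq hg]
  congr 1
  rw [← neg_mul, neg_neg, mul_div_mul_left _ _ (by norm_num)]

theorem IsSolution.rho_nonneg (h : IsSolution t₀ g k f) {t : ℝ} (ht : t ∈ Ici t₀) :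
    0 ≤ rho (g t) (f t) :=
  BianchiV.rho_nonneg (h.distr_nonneg t ht)

theorem IsSolution.normSq_traceless_nonneg (h : IsSolution t₀ g k f) {t : ℝ} (ht : t ∈ Ici t₀) :
    0 ≤ normSq (g t) (k t + hubble (g t) (k t) • g t) :=
  normSq_nonneg (h.metric_posDef t ht)
    (traceless_symm (h.metric_symm ht) (h.second_symm ht) _)

theorem IsSolution.inv_pos (h : IsSolution t₀ g k f) {t : ℝ} (ht : t ∈ Ici t₀) :
    0 < (g t)⁻¹ 0 0 :=
  (h.metric_posDef t ht).inv.diag_pos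

/-- At `H = 0` the Hamiltonian constraint would equate `-6 g⁰⁰ < 0` with a nonnegative quantity. By
continuity expansion never stops. -/
theorem IsSolution.hubble_ne_zero (h : IsSolution t₀ g k f) {t : ℝ} (ht : t ∈ Ici t₀) :
    hubble (g t) (k t) ≠ 0 := by
  intro h0
  have h1 := h.hamiltonian ht
  have h2 := h.normSq_traceless_nonneg ht
  have h3 := h.inv_pos ht
  have h4 := mul_nonneg Real.pi_pos.le (h.rho_nonneg ht)
  rw [h0] at h1 h2
  nlinarith

theorem IsSolution.hubble_pos (h : IsSolution t₀ g k f) (h₀ : 0 < hubble (g t₀) (k t₀)) {t : ℝ}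
    (ht : t ∈ Ici t₀) : 0 < hubble (g t) (k t) := by
  by_contra! hle
  obtain ⟨s, hs, hs0⟩ := intermediate_value_Icc' ht
    (h.continuousOn_hubble.mono Icc_subset_Ici_self) ⟨hle, h₀.le⟩
  exact h.hubble_ne_zero hs.1 hs0

theorem IsSolution.curvDeviation_mul (h : IsSolution t₀ g k f) {t : ℝ} (ht : t ∈ Ici t₀) :
    6 * (hubble (g t) (k t) ^ 2 * curvDeviation (g t) (k t))
      = normSq (g t) (k t + hubble (g t) (k t) • g t) + 16 * Real.pi * rho (g t) (f t) := by
  have hH := h.hubble_ne_zero ht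
  rw [← h.hamiltonian ht, curvDeviation, mul_sub, mul_one, mul_div_cancel₀ _ (by positivity)]
  ring

theorem IsSolution.curvDeviation_nonneg (h : IsSolution t₀ g k f) {t : ℝ} (ht : t ∈ Ici t₀) :
    0 ≤ curvDeviation (g t) (k t) := by
  have h1 := h.curvDeviation_mul ht
  have h2 := h.normSq_traceless_nonneg ht
  have h4 := mul_nonneg Real.pi_pos.le (h.rho_nonneg ht)
  have hH := h.hubble_ne_zero ht
  refine nonneg_of_mul_nonneg_right (a := hubble (g t) (k t) ^ 2) ?_ (by positivity)
  linarith

theorem IsSolution.hasDerivWithinAt_curvDeviation (h : IsSolution t₀ g k f) {t : ℝ}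
    (ht : t ∈ Ici t₀) :
    HasDerivWithinAt (fun r => curvDeviation (g r) (k r))
      (-2 * ((g t)⁻¹ * (k t + hubble (g t) (k t) • g t) * (g t)⁻¹) 0 0 / hubble (g t) (k t) ^ 2
        - 2 / 3 * (g t)⁻¹ 0 0 * (normSq (g t) (k t + hubble (g t) (k t) • g t)
          + 4 * Real.pi * (rho (g t) (f t) + stressTrace (g t) (f t)))
          / hubble (g t) (k t) ^ 3) (Ici t₀) t := by
  have hH := h.hubble_ne_zero ht
  refine ((((h.hasDerivWithinAt_inv ht 0 0).div ((h.hasDerivWithinAt_hubble ht).fun_pow 2)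
    (by positivity)).const_sub 1)).congr_deriv ?_
  rw [contract_eq (k t) (h.metric_posDef t ht) (hubble (g t) (k t)), Matrix.sub_apply,
    Matrix.smul_apply, smul_eq_mul]
  field_simp
  push_cast
  ring

theorem IsSolution.stressTrace_nonneg (h : IsSolution t₀ g k f) {t : ℝ} (ht : t ∈ Ici t₀) :
    0 ≤ stressTrace (g t) (f t) :=
  BianchiV.stressTrace_nonneg (h.metric_posDef t ht) (h.continuous_distr ht)
    (h.distr_compact t ht) (h.distr_nonneg t ht)

theorem IsSolution.stressTrace_le_rho (h : IsSolution t₀ g k f) {t : ℝ} (ht : t ∈ Ici t₀) :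
    stressTrace (g t) (f t) ≤ rho (g t) (f t) :=
  BianchiV.stressTrace_le_rho (h.metric_posDef t ht) (h.continuous_distr ht)
    (h.distr_compact t ht) (h.distr_nonneg t ht)

/-- The decay of `1 - A`, from the momentum constraint. -/
theorem IsSolution.curvDeviation_deriv_le (h : IsSolution t₀ g k f) {t W : ℝ} (ht : t ∈ Ici t₀)
    (hH : 0 < hubble (g t) (k t))
    (hW : ∀ p, f t p ≠ 0 → p ⬝ᵥ ((g t)⁻¹ *ᵥ p) ≤ W) :
    -2 * ((g t)⁻¹ * (k t + hubble (g t) (k t) • g t) * (g t)⁻¹) 0 0 / hubble (g t) (k t) ^ 2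
        - 2 / 3 * (g t)⁻¹ 0 0 * (normSq (g t) (k t + hubble (g t) (k t) • g t)
          + 4 * Real.pi * (rho (g t) (f t) + stressTrace (g t) (f t)))
          / hubble (g t) (k t) ^ 3
      ≤ hubble (g t) (k t) * curvDeviation (g t) (k t)
        * (2 * √W + curvDeviation (g t) (k t) - 1) := by
  have hmom := h.momentum ht
  have hcur := abs_sum_inv_mul_current_le (h.metric_posDef t ht) (h.continuous_distr ht)
    (h.distr_compact t ht) (h.distr_nonneg t ht) hW
  have hdev := h.curvDeviation_mul ht
  have hD := h.curvDeviation_nonneg ht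
  have hs := h.normSq_traceless_nonneg ht
  have hr := h.rho_nonneg ht
  have hS := h.stressTrace_nonneg ht
  have hy := h.inv_pos ht
  have hyeq : (g t)⁻¹ 0 0
      = hubble (g t) (k t) ^ 2 * (1 - curvDeviation (g t) (k t)) := by
    rw [curvDeviation]; field_simp; ring
  generalize hubble (g t) (k t) = H at *
  generalize curvDeviation (g t) (k t) = D at *
  generalize normSq (g t) (k t + H • g t) = s at *
  generalize ((g t)⁻¹ * (k t + H • g t) * (g t)⁻¹) 0 0 = c at *
  generalize ∑ b, (g t)⁻¹ 0 b * current (g t) (f t) b = j at *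
  generalize rho (g t) (f t) = r at *
  generalize stressTrace (g t) (f t) = S at *
  generalize (g t)⁻¹ 0 0 = y at *
  have hpi := Real.pi_pos
  have hpr : 0 ≤ Real.pi * r := by positivity
  have hpS : 0 ≤ Real.pi * S := by positivity
  have hsy : √y ≤ H := by
    rw [Real.sqrt_le_left hH.le, hyeq]
    nlinarith [mul_nonneg (sq_nonneg H) hD]
  -- `-c = (8π/3) j` with `j ≤ H √W ρ`, and `16πρ ≤ 6 H² D`; the constants multiply to `1`.
  have h1 : -c ≤ H ^ 3 * √W * D := by
    have h2 : j ≤ H * √W * r := (le_abs_self _).trans (hcur.trans (by gcongr))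
    have h3 : Real.pi * j ≤ Real.pi * (H * √W * r) := by gcongr
    have h4 : H * √W * (Real.pi * r) ≤ H * √W * (6 / 16 * (H ^ 2 * D)) :=
      mul_le_mul_of_nonneg_left (by linarith) (by positivity)
    nlinarith
  -- The factor `1/2` is the value for dust without shear, the slowest case; it produces the damping
  -- `-H D (1 - D)`.
  have h5 : H ^ 2 * D / 2 ≤ 1 / 3 * (s + 4 * Real.pi * (r + S)) := by nlinarith
  have h6 : -2 * c / H ^ 2 ≤ 2 * H * √W * D := by
    rw [div_le_iff₀ (by positivity)]
    linarith
  have h7 : y * D / H ≤ 2 / 3 * y * (s + 4 * Real.pi * (r + S)) / H ^ 3 := by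
    rw [div_le_div_iff₀ hH (by positivity)]
    have := mul_le_mul_of_nonneg_left h5 (by positivity : 0 ≤ 2 * y * H)
    linarith
  have h8 : y * D / H = H * D * (1 - D) := by rw [hyeq]; field_simp
  linarith

/-- The solution of `W' = 2 (|σ| - H) W` with `W(t₀) = w`. -/
theorem IsSolution.exists_momentum_barrier (h : IsSolution t₀ g k f) {w : ℝ} (hw : 0 < w) :
    ∃ W : ℝ → ℝ, W t₀ = w ∧ (∀ t, 0 < W t) ∧ ∀ t ∈ Ici t₀, HasDerivWithinAt W
      (2 * (√(normSq (g t) (k t + hubble (g t) (k t) • g t)) - hubble (g t) (k t)) * W t)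
      (Ici t₀) t := by
  set l : ℝ → ℝ := fun t =>
    2 * (√(normSq (g t) (k t + hubble (g t) (k t) • g t)) - hubble (g t) (k t)) with hl
  have hlc : ContinuousOn l (Ici t₀) :=
    continuousOn_const.mul (h.continuousOn_normSq.sqrt.sub h.continuousOn_hubble)
  -- Freezing the rate to the left of `t₀` makes it continuous on the whole line, so the integral is
  -- differentiable at `t₀` too.
  have hc : Continuous fun s => l (max t₀ s) :=
    hlc.comp_continuous (by fun_prop) fun s => le_max_left t₀ s
  refine ⟨fun t => w * Real.exp (∫ s in t₀..t, l (max t₀ s)), by simp, fun t => by positivity,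
    fun t ht => ?_⟩
  have h1 := ((hc.integral_hasStrictDerivAt t₀ t).hasDerivAt.exp.const_mul w).hasDerivWithinAt
    (s := Ici t₀)
  refine h1.congr_deriv ?_
  rw [max_eq_right ht]
  ring

theorem momentumNorm_le_maxMomentum {g : Mat} {f : Vec → ℝ} (hc : HasCompactSupport f) {p : Vec}
    (hp : f p ≠ 0) : momentumNorm g p ≤ maxMomentum g f := by
  have hcont : Continuous (momentumNorm g) := (continuous_quadForm _).sqrt
  refine le_csSup ?_ ⟨p, hp, rfl⟩
  refine (hc.isCompact.bddAbove_image hcont.continuousOn).mono ?_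
  rintro _ ⟨q, hq, rfl⟩
  exact ⟨q, subset_tsupport f hq, rfl⟩

/-- The momenta decay like `t⁻¹` if the data are close to the Milne universe. -/
theorem IsSolution.exists_momentum_le (h : IsSolution t₀ g k f) (ht₀ : 0 < t₀)
    (hnorm : t₀ = -3 / meanCurv (g t₀) (k t₀))
    (hA : |curvVar (g t₀) (k t₀) - 1| ≤ 1 / 200)
    (hP : maxMomentum (g t₀) (f t₀) ≤ 1 / 200) :
    ∃ C, 0 ≤ C ∧ ∀ t ∈ Ici t₀, ∀ p, f t p ≠ 0 → p ⬝ᵥ ((g t)⁻¹ *ᵥ p) ≤ (C / t) ^ 2 := by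
  have hH₀ : hubble (g t₀) (k t₀) = t₀⁻¹ := by
    have h1 : t₀⁻¹ = (-3 / meanCurv (g t₀) (k t₀))⁻¹ := congrArg _ hnorm
    rw [h1, inv_div, hubble]
    ring
  have hHpos : ∀ t ∈ Ici t₀, 0 < hubble (g t) (k t) := fun t ht =>
    h.hubble_pos (by rw [hH₀]; positivity) ht
  -- Starting from the fixed bound rather than from the actual maximal momentum keeps `W` positive
  -- even in vacuum.
  obtain ⟨W, hW₀, hWpos, hW⟩ := h.exists_momentum_barrier (w := (1 / 200) ^ 2) (by norm_num)
  have hsupp : ∀ t ∈ Ici t₀, ∀ p, f t p ≠ 0 → p ⬝ᵥ ((g t)⁻¹ *ᵥ p) ≤ W t := fun t ht p hp => by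
    refine h.norm_le_of_distr_ne_zero (fun t _ => hWpos t) hW (fun q hq => ?_) ht p hp
    rw [hW₀]
    exact (Real.sqrt_le_left (by norm_num)).1
      ((momentumNorm_le_maxMomentum (h.distr_compact t₀ self_mem_Ici) hq).trans hP)
  have hD₀ : curvDeviation (g t₀) (k t₀) ≤ 1 / 200 := by
    rw [curvDeviation_eq (h.metric_posDef t₀ self_mem_Ici)]
    linarith [(abs_le.1 hA).1]
  obtain ⟨C, hC, hle⟩ := exists_le_div_sq ht₀
    (fun t ht => h.hasDerivWithinAt_hubble ht) (fun t ht => h.hasDerivWithinAt_curvDeviation ht)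
    hW hHpos (fun t ht => h.curvDeviation_nonneg ht) (fun t _ => hWpos t)
    (fun t ht => by
      have := h.normSq_traceless_nonneg ht
      have := mul_nonneg Real.pi_pos.le (h.rho_nonneg ht)
      have := mul_nonneg Real.pi_pos.le (h.stressTrace_nonneg ht)
      linarith)
    (fun t ht => by
      have := h.normSq_traceless_nonneg ht
      have := h.curvDeviation_mul ht
      have := mul_nonneg Real.pi_pos.le (h.rho_nonneg ht)
      have := mul_le_mul_of_nonneg_left (h.stressTrace_le_rho ht) Real.pi_pos.le
      linarith)
    (fun t ht => h.curvDeviation_deriv_le ht (hHpos t ht) (hsupp t ht))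
    (fun t ht => by
      have hH := hHpos t ht
      have hr := mul_nonneg Real.pi_pos.le (h.rho_nonneg ht)
      have hdev := h.curvDeviation_mul ht
      have h1 : √(normSq (g t) (k t + hubble (g t) (k t) • g t))
          ≤ hubble (g t) (k t) * √(6 * curvDeviation (g t) (k t)) := by
        rw [← Real.sqrt_sq hH.le, ← Real.sqrt_mul (sq_nonneg _), Real.sqrt_sq hH.le]
        exact Real.sqrt_le_sqrt (by linarith)
      have := mul_le_mul_of_nonneg_right h1 (hWpos t).le
      linarith)
    hH₀ (by rw [hW₀]; linarith)
  refine ⟨√C, Real.sqrt_nonneg C, fun t ht p hp => ?_⟩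
  rw [div_pow, Real.sq_sqrt hC.le]
  exact (hsupp t ht p hp).trans (hle t ht)

theorem isBigO_zpow_neg {u : ℝ → ℝ} {B : ℝ} (n : ℕ) (ht₀ : 0 < t₀)
    (h : ∀ t ∈ Ici t₀, |u t| ≤ B * t⁻¹ ^ n) : u =O[atTop] fun t : ℝ => t ^ (-(n : ℤ)) := by
  refine IsBigO.of_bound B ?_
  filter_upwards [eventually_ge_atTop t₀] with t ht
  have ht' : 0 < t := ht₀.trans_le ht
  rw [Real.norm_eq_abs, Real.norm_eq_abs, zpow_neg, zpow_natCast, ← inv_pow,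
    abs_of_pos (pow_pos (inv_pos.2 ht') n)]
  exact h t ht

end Asymptotics

end BianchiV

end

/-! ### The decay rates -/

theorem mainTheorem6 :
    ∃ ε : ℝ, 0 < ε ∧
      ∀ (t₀ : ℝ) (g k : ℝ → BianchiV.Mat) (f : ℝ → BianchiV.Vec → ℝ),
        BianchiV.IsSolution t₀ g k f →
        0 < t₀ →
        t₀ = -3 / BianchiV.meanCurv (g t₀) (k t₀) →
        |BianchiV.shearPlus (g t₀) (k t₀)| ≤ ε →
        |BianchiV.shearMinus (g t₀) (k t₀)| ≤ ε →
        (∀ i j : Fin 3, i ≠ j → |BianchiV.shear (g t₀) (k t₀) i j| ≤ ε) →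
        |BianchiV.curvVar (g t₀) (k t₀) - 1| ≤ ε →
        BianchiV.maxMomentum (g t₀) (f t₀) ≤ ε →
        ((fun t => BianchiV.rho (g t) (f t)) =O[atTop] fun t : ℝ => t ^ (-3 : ℤ)) ∧
        ∀ e : ℝ → BianchiV.Mat, BianchiV.IsOrthonormalFrame t₀ g e →
          (∀ i : Fin 3,
            (fun t => BianchiV.frameVec (e t) (BianchiV.current (g t) (f t)) i)
              =O[atTop] fun t : ℝ => t ^ (-4 : ℤ)) ∧
          (∀ i j : Fin 3,
            (fun t => BianchiV.frameMat (e t) (BianchiV.stress (g t) (f t)) i j)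
              =O[atTop] fun t : ℝ => t ^ (-5 : ℤ)) := by
  refine ⟨1 / 200, by norm_num, fun t₀ g k f h ht₀ hnorm _ _ _ hA hP => ?_⟩
  obtain ⟨C, hC, hsupp⟩ := h.exists_momentum_le ht₀ hnorm hA hP
  obtain ⟨M, hM⟩ := (h.distr_compact t₀ self_mem_Ici).exists_bound_of_continuous
    (h.continuous_distr self_mem_Ici)
  have hf : ∀ t ∈ Ici t₀, ∀ p, |f t p| ≤ M := fun t ht p => by
    rw [abs_of_nonneg (h.distr_nonneg t ht p)]
    exact h.distr_le (fun q => (le_abs_self _).trans (hM q)) ht p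
  have hM0 : 0 ≤ M := (abs_nonneg _).trans (hM 0)
  have hsqrt : ∀ t ∈ Ici t₀, √((C / t) ^ 2) = C * t⁻¹ := fun t ht => by
    rw [Real.sqrt_sq (div_nonneg hC (ht₀.le.trans ht)), div_eq_mul_inv]
  refine ⟨BianchiV.isBigO_zpow_neg (B := M * √(1 + (C / t₀) ^ 2) * (8 * C ^ 3)) 3 ht₀
    fun t ht => ?_, fun e he => ⟨fun i => BianchiV.isBigO_zpow_neg (B := M * C * (8 * C ^ 3)) 4 ht₀
    fun t ht => ?_, fun i j => BianchiV.isBigO_zpow_neg (B := M * (C * C) * (8 * C ^ 3)) 5 ht₀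
    fun t ht => ?_⟩⟩
  · refine (BianchiV.rho_le (h.metric_posDef t ht) (hf t ht) (hsupp t ht)).trans ?_
    have ht' : 0 < t := ht₀.trans_le ht
    -- The particle energy stays bounded, so it does not affect the rate of `ρ`.
    have h1 : √(1 + (C / t) ^ 2) ≤ √(1 + (C / t₀) ^ 2) := by
      have : C / t ≤ C / t₀ := div_le_div_of_nonneg_left hC ht₀ ht
      gcongr
    rw [hsqrt t ht]
    calc _ ≤ M * √(1 + (C / t₀) ^ 2) * (8 * (C * t⁻¹) ^ 3) := by gcongr
      _ = _ := by ring
  · refine (BianchiV.frameVec_current_le (h.metric_posDef t ht) (h.continuous_distr ht)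
      (h.distr_compact t ht) (hf t ht) (hsupp t ht) (he t ht) i).trans_eq ?_
    rw [hsqrt t ht]
    ring
  · refine (BianchiV.frameMat_stress_le (h.metric_posDef t ht) (h.continuous_distr ht)
      (h.distr_compact t ht) (hf t ht) (hsupp t ht) (he t ht) i j).trans_eq ?_
    rw [hsqrt t ht]
    ring
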